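/- Let $\tau\in\mathbb C$ with $\operatorname{Im}\tau>0$, $\Lambda=\mathbb Z+\tau\mathbb Z$, $\vartheta(u)=-i\sum_{k\in\mathbb Z}(-1)^k e^{\pi i\tau(k+1/2)^2}e^{\pi i(2k+1)u}$, $\phi(x,u)=\dfrac{\vartheta'(0)\vartheta(x+u)}{\vartheta(x)\vartheta(u)}$, $(\omega_0,\omega_1,\omega_2,\omega_3)=(0,\tfrac12,\tfrac{1+\tau}2,\tfrac\tau2)$, and let $\wp$ be the Weierstrass function of $\Lambda$. Let $c,\eta,\bar\eta\in\mathbb C$ with $c\ne0$, $2\eta,2\bar\eta\notin\Lambda$, and let $\nu=(\nu_a)_{a=0}^3,\ \bar\nu=(\bar\nu_a)_{a=0}^3\in\mathbb C^4$. Put $$v(z,u)=\sum_{a=0}^3\nu_a e^{4\pi i z\,\partial_\tau\omega_a}\phi(2z,u+\omega_a),\qquad \bar v(z,u)=\sum_{a=0}^3\bar\nu_a e^{4\pi i z\,\partial_\tau\omega_a}\phi(2z,u+\omega_a),$$ and let $v'(z,u)=\partial_uv(z,u)$, $\bar v'(z,u)=\partial_u\bar v(z,u)$ (so $v'(z,-q)$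 is $\partial_uv(z,u)$ at $u=-q$). Let $$H(q,p)=v(\eta,q)\bar v(\bar\eta,q)e^{p/c}+v(\eta,-q)\bar v(\bar\eta,-q)e^{-p/c}-2\sum_{a=0}^3\nu_a\bar\nu_a\wp(q+\omega_a)$$ on the phase space $X$ of all $(q,p)\in\mathbb C^2$ such that $q+\omega_a\notin\Lambda$ for every $a$ with $\nu_a\neq0$ or $\bar\nu_a\ne0$. For $2z\notin\Lambda$ let $\mathcal L(z)=L(z)\bar L(z)$ with $$L(z)=\begin{pmatrix}v(\eta,q)e^{p/2c}&v(z,q)\\v(z,-q)&v(\eta,-q)e^{-p/2c}\end{pmatrix},\qquad \bar L(z)=\begin{pmatrix}\bar v(\bar\eta,q)e^{p/2c}&\bar v(z,q)\\\bar v(z,-q)&\bar v(\bar\eta,-q)e^{-p/2c}\end{pmatrix},$$ and let $\mathcal M(z)=\frac1c\begin{pmatrix}\mathcal M_{11}&\mathcal M_{12}\\\mathcal M_{21}&\mathcal M_{22}\end{pmatrix}$ with $$\begin{aligned}\mathcal M_{11}&=-v'(\eta,q)\bar v(\bar\eta,q)e^{p/c}+\bar v'(z,-q)v(z,q)+\tfrac14\partial_qH,\\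 \mathcal M_{12}&=v(\eta,q)\bar v'(z,q)e^{p/2c}+\bar v(\bar\eta,-q)v'(z,q)e^{-p/2c},\\ \mathcal M_{21}&=v(\eta,-q)\bar v'(z,-q)e^{-p/2c}+\bar v(\bar\eta,q)v'(z,-q)e^{p/2c},\\ \mathcal M_{22}&=-v'(\eta,-q)\bar v(\bar\eta,-q)e^{-p/c}+\bar v'(z,q)v(z,-q)-\tfrac14\partial_qH.\end{aligned}$$ Then the following hold. (0) On $X$, with $w(u)=v(\eta,u)\bar v(\bar\eta,u)$, one has $\partial_pH=\frac1c\big(w(q)e^{p/c}-w(-q)e^{-p/c}\big)$ and $\partial_qH=w'(q)e^{p/c}-w'(-q)e^{-p/c}-2\sum_a\nu_a\bar\nu_a\wp'(q+\omega_a)$. (1) If a curve $(q(t),p(t))$ satisfies Hamilton's equations $\dot q=\partial_pH$, $\dot p=-\partial_qH$ at a time $t$ with $(q(t),p(t))\in X$, then it satisfies the Lax equation $\dot{\mathcal L}(z)=[\mathcal L(z),\mathcal M(z)]$ at $t$ for all $z$ with $2z\notin\Lambda$. (2) Conversely, if a curve is differentiable at $t$, $(q(t),p(t))\in X$, $dH\neq0$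 at this point, and the Lax equation holds at $t$ for one $z$ with $2z\notin\Lambda$ and $[\mathcal L(z),\mathcal M(z)]\ne0$ at this point, then Hamilton's equations hold at $t$. (3) Suppose $\nu\ne0$ and $\bar\nu\neq0$. Let $N\subset X$ be the set of points at which no nonzero $(a,b)\in\mathbb C^2$ satisfies $a\,\partial_q\mathcal L(z)+b\,\partial_p\mathcal L(z)=0$ for all $z$ with $2z\notin\Lambda$. Then $N$ is open and dense in $X$, and for every curve differentiable at $t$ with $(q(t),p(t))\in N$, Hamilton's equations hold at $t$ if and only if the Lax equation holds at $t$ for all $z$ with $2z\notin\Lambda$. (4) Suppose $\nu\ne0$ and $\bar\nu\ne0$. For all continuous $Q,P:X\to\mathbb C$, the system $\dot q=Q(q,p)$, $\dot p=P(q,p)$ is Hamilton's system, i.e. $Q=\partial_pH$ and $P=-\partial_qH$ on $X$, if and only if it implies the Lax equation, i.e. $Q\,\partial_q\mathcal L(z)+P\,\partial_p\mathcal L(z)=[\mathcal L(z),\mathcal M(z)]$ on $X$ for all $z$ with $2z\notin\Lambda$. -/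

import Mathlib

open Complex

noncomputable section

namespace VanDiejen

/-- The periods `1, τ` of the elliptic curve `ℂ / (ℤ + τ ℤ)`. -/
def periods (τ : UpperHalfPlane) : PeriodPair where
  ω₁ := 1
  ω₂ := (τ : ℂ)
  indep := by
    rw [LinearIndependent.pair_iff]
    intro s t h
    have him := congrArg Complex.im h
    have hre := congrArg Complex.re h
    have hτ : (τ : ℂ).im ≠ 0 := τ.im_ne_zero
    simp at him hre
    have ht : t = 0 := by
      rcases him with h0 | h0
      · exact h0
      · exact absurd h0 hτ
    subst ht
    simpa using hre

/-- The first Jacobi theta function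
`ϑ(u) = -i ∑_{k ∈ ℤ} (-1)^k exp(π i τ (k + 1/2)²) exp(π i (2 k + 1) u)`. -/
def theta (τ : UpperHalfPlane) (u : ℂ) : ℂ :=
  -I * ∑' k : ℤ, (-1 : ℂ) ^ k * exp (Real.pi * I * (τ : ℂ) * ((k : ℂ) + 1 / 2) ^ 2)
    * exp (Real.pi * I * (2 * (k : ℂ) + 1) * u)

/-- The elliptic Kronecker function `φ(x, u) = ϑ'(0) ϑ(x + u) / (ϑ(x) ϑ(u))`. -/
def kronecker (τ : UpperHalfPlane) (x u : ℂ) : ℂ :=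
  deriv (theta τ) 0 * theta τ (x + u) / (theta τ x * theta τ u)

/-- The half-periods `ω₀ = 0`, `ω₁ = 1/2`, `ω₂ = (1 + τ)/2`, `ω₃ = τ/2`. -/
def halfPeriod (τ : UpperHalfPlane) : Fin 4 → ℂ := ![0, 1 / 2, (1 + (τ : ℂ)) / 2, (τ : ℂ) / 2]

/-- The derivatives `∂_τ ω_a` of the half-periods with respect to `τ`. -/
def halfPeriodDeriv : Fin 4 → ℂ := ![0, 0, 1 / 2, 1 / 2]

/-- `v(z, u | ν) = ∑ₐ νₐ exp(4 π i z ∂_τ ωₐ) φ(2 z, u + ωₐ)`. -/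
def v (τ : UpperHalfPlane) (ν : Fin 4 → ℂ) (z u : ℂ) : ℂ :=
  ∑ a, ν a * exp (4 * Real.pi * I * z * halfPeriodDeriv a)
    * kronecker τ (2 * z) (u + halfPeriod τ a)

/-- `v'(z, u | ν)`: the derivative of `v` in its second argument; thus `v' τ ν z (-q)` is
`∂_u v(z, u)` at `u = -q`. -/
def v' (τ : UpperHalfPlane) (ν : Fin 4 → ℂ) (z u : ℂ) : ℂ := deriv (fun w => v τ ν z w) u

/-- The elliptic modulus and the constants of the model. -/
structure Model where
  τ : UpperHalfPlane
  c : ℂ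
  η : ℂ
  ηbar : ℂ
  ν : Fin 4 → ℂ
  νbar : Fin 4 → ℂ

namespace Model

variable (m : Model)

/-- The period lattice `ℤ + τ ℤ`. -/
def lattice : Submodule ℤ ℂ := (periods m.τ).lattice

/-- The Hamiltonian of the model. -/
def hamiltonian (q p : ℂ) : ℂ :=
  v m.τ m.ν m.η q * v m.τ m.νbar m.ηbar q * exp (p / m.c)
    + v m.τ m.ν m.η (-q) * v m.τ m.νbar m.ηbar (-q) * exp (-p / m.c)
    - 2 * ∑ a, m.ν a * m.νbar a * (periods m.τ).weierstrassP (q + halfPeriod m.τ a)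

/-- `∂_q H` -/
def dqH (q p : ℂ) : ℂ := deriv (fun x => m.hamiltonian x p) q

/-- `∂_p H` -/
def dpH (q p : ℂ) : ℂ := deriv (fun y => m.hamiltonian q y) p

/-- The phase space: the pairs `(q, p)` for which `q` is not a pole `-ωₐ + (ℤ + τ ℤ)` of one of the
terms with a nonzero coefficient. -/
def phaseSpace : Set (ℂ × ℂ) :=
  {x | ∀ a, (m.ν a ≠ 0 ∨ m.νbar a ≠ 0) → x.1 + halfPeriod m.τ a ∉ m.lattice}

/-- The admissible values of the spectral parameter. -/
def spectralDomain : Set ℂ := {z | 2 * z ∉ m.lattice}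

/-- The factor `L(z)`. -/
def L (z q p : ℂ) : Matrix (Fin 2) (Fin 2) ℂ :=
  !![v m.τ m.ν m.η q * exp (p / (2 * m.c)), v m.τ m.ν z q;
     v m.τ m.ν z (-q), v m.τ m.ν m.η (-q) * exp (-p / (2 * m.c))]

/-- The factor `L̄(z)`. -/
def Lbar (z q p : ℂ) : Matrix (Fin 2) (Fin 2) ℂ :=
  !![v m.τ m.νbar m.ηbar q * exp (p / (2 * m.c)), v m.τ m.νbar z q;
     v m.τ m.νbar z (-q), v m.τ m.νbar m.ηbar (-q) * exp (-p / (2 * m.c))]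

/-- The symmetric Lax matrix `ℒ(z) = L(z) L̄(z)`. -/
def lax (z q p : ℂ) : Matrix (Fin 2) (Fin 2) ℂ := m.L z q p * m.Lbar z q p

/-- The matrix `ℳ(z)`. -/
def M (z q p : ℂ) : Matrix (Fin 2) (Fin 2) ℂ :=
  (1 / m.c) •
    !![-(v' m.τ m.ν m.η q * v m.τ m.νbar m.ηbar q * exp (p / m.c))
          + v' m.τ m.νbar z (-q) * v m.τ m.ν z q + 1 / 4 * m.dqH q p,
       v m.τ m.ν m.η q * v' m.τ m.νbar z q * exp (p / (2 * m.c))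
          + v m.τ m.νbar m.ηbar (-q) * v' m.τ m.ν z q * exp (-p / (2 * m.c));
       v m.τ m.ν m.η (-q) * v' m.τ m.νbar z (-q) * exp (-p / (2 * m.c))
          + v m.τ m.νbar m.ηbar q * v' m.τ m.ν z (-q) * exp (p / (2 * m.c)),
       -(v' m.τ m.ν m.η (-q) * v m.τ m.νbar m.ηbar (-q) * exp (-p / m.c))
          + v' m.τ m.νbar z q * v m.τ m.ν z (-q) - 1 / 4 * m.dqH q p]

/-- The commutator `[ℒ(z), ℳ(z)]`. -/
def laxCommutator (z q p : ℂ) : Matrix (Fin 2) (Fin 2) ℂ :=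
  m.lax z q p * m.M z q p - m.M z q p * m.lax z q p

/-- Hamilton's equations `q̇ = ∂_p H`, `ṗ = -∂_q H` for the curve `(q, p)` at time `t`. -/
def HamiltonAt (q p : ℝ → ℂ) (t : ℝ) : Prop :=
  HasDerivAt q (m.dpH (q t) (p t)) t ∧ HasDerivAt p (-m.dqH (q t) (p t)) t

/-- The Lax equation `d/dt ℒ(z) = [ℒ(z), ℳ(z)]` at the value `z` of the spectral parameter,
for the curve `(q, p)` at time `t`. -/
def LaxEqAt (z : ℂ) (q p : ℝ → ℂ) (t : ℝ) : Prop :=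
  ∀ i j, HasDerivAt (fun s => m.lax z (q s) (p s) i j) (m.laxCommutator z (q t) (p t) i j) t

/-- The Lax equation, identically in the spectral parameter. -/
def LaxAt (q p : ℝ → ℂ) (t : ℝ) : Prop :=
  ∀ z ∈ m.spectralDomain, m.LaxEqAt z q p t

/-- The derivative `a ∂_q ℒ(z) + b ∂_p ℒ(z)` of the Lax matrix in the direction `(a, b)`. -/
def laxVariation (z q p a b : ℂ) : Matrix (Fin 2) (Fin 2) ℂ :=
  Matrix.of fun i j =>
    a * deriv (fun x => m.lax z x p i j) q + b * deriv (fun y => m.lax z q y i j) p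

/-- The points of the phase space at which the Lax matrix, as a function of the spectral parameter,
detects every nonzero velocity. -/
def nondegenerateSet : Set (ℂ × ℂ) :=
  {x ∈ m.phaseSpace | ∀ a b : ℂ,
    (∀ z ∈ m.spectralDomain, m.laxVariation z x.1 x.2 a b = 0) → a = 0 ∧ b = 0}

end Model

end VanDiejen

end

/-! Write ℒ_q, ℒ_p, H_q, H_p for the partial derivatives. The core is the pointwise identity [ℒ, ℳ]
= H_p ℒ_q − H_q ℒ_p (`laxCommutator_eq`). By the chain rule a velocity (a, b) satisfies the Lax
equation exactly when a ℒ_q + b ℒ_p equals this expression. Hamilton's equations therefore imply it,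
and the converse asks how far ℒ_q and ℒ_p determine (a, b).

The identity has one analytic input: v(z,u) v̄(z,−u) + v(z,−u) v̄(z,u) + 2 ∑ νₐ ν̄ₐ ℘(u + ωₐ) is
elliptic in u with removable singularities, hence constant in u by Liouville
(`v_symm_add_weierstrassP`). Its derivative in u shows that tr ℒ and H have the same partial
derivatives. For ν̄ = ν it shows that v'(z,q) v(z,−q) − v(z,q) v'(z,−q) does not depend on z
(`v_antisymm_deriv`). Given these facts and e^{p/2c} e^{−p/2c} = 1, the identity is algebra. The
pole analysis needs ϑ to vanish only on Λ, with a simple zero at 0; this is read off from the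
product form of ϑ.

For the converse at a single z, a commutator has trace zero, so a H_q + b H_p = 0. As dH ≠ 0, (a, b)
= r (H_p, −H_q), and the Lax equation becomes (r − 1) [ℒ, ℳ] = 0.

With all z available, (a, b) is determined as soon as some 2×2 minor of the entries of ℒ_q and ℒ_p
is nonzero. The minor of the upper right entries at two spectral values is, up to a nonvanishing
factor, a quadratic polynomial in e^{p/c}. Its leading coefficient is v(η,q)² times a Wronskian of
v̄(z₁,·) and v̄(z₂,·), which is not identically zero if these functions have different multipliers
under u ↦ u + τ (`exists_wronskian_v_ne_zero`). This gives density of the nondegenerate points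
(`phaseSpace_subset_closure`), and continuity carries the statement on vector fields to all of X. -/

noncomputable section

namespace VanDiejen

open Filter Topology

/-! ### Infinite products -/

/-- The infinite product `∏ (1 - Q ^ n x)`. -/
def qPochhammer (Q x : ℂ) : ℂ := ∏' n : ℕ, (1 - Q ^ n * x)

lemma summable_norm_neg_pow_mul {Q : ℂ} (hQ : ‖Q‖ < 1) (x : ℂ) :
    Summable fun n : ℕ => ‖-(Q ^ n * x)‖ := by
  simpa using (summable_geometric_of_lt_one (norm_nonneg _) hQ).mul_right ‖x‖

lemma qPochhammer_eq_mul {Q : ℂ} (hQ : ‖Q‖ < 1) (x : ℂ) :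
    qPochhammer Q x = (1 - x) * qPochhammer Q (Q * x) := by
  have hm : Multipliable fun n : ℕ => 1 - Q ^ n * (Q * x) := by
    simpa [sub_eq_add_neg] using
      multipliable_one_add_of_summable (summable_norm_neg_pow_mul hQ (Q * x))
  have h : ∀ n : ℕ, 1 - Q ^ n * (Q * x) = 1 - Q ^ (n + 1) * x := fun n => by ring
  rw [qPochhammer, tprod_eq_zero_mul' (by simpa [h] using hm), qPochhammer]
  simp [h]

lemma qPochhammer_ne_zero {Q : ℂ} (hQ : ‖Q‖ < 1) {x : ℂ} (h : ∀ n : ℕ, Q ^ n * x ≠ 1) :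
    qPochhammer Q x ≠ 0 := by
  have := tprod_one_add_ne_zero_of_summable (f := fun n : ℕ => -(Q ^ n * x))
    (fun n => by rw [← sub_eq_add_neg, sub_ne_zero]; exact (h n).symm)
    (summable_norm_neg_pow_mul hQ x)
  simpa [qPochhammer, sub_eq_add_neg] using this

lemma differentiable_qPochhammer {Q : ℂ} (hQ : ‖Q‖ < 1) : Differentiable ℂ (qPochhammer Q) := by
  intro x
  have hx : x ∈ Metric.ball (0 : ℂ) (‖x‖ + 1) := by simp
  have h := Summable.hasProdLocallyUniformlyOn_nat_one_add
    (f := fun (n : ℕ) (y : ℂ) => -(Q ^ n * y))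
    (K := Metric.ball (0 : ℂ) (‖x‖ + 1)) (u := fun n => ‖Q‖ ^ n * (‖x‖ + 1)) Metric.isOpen_ball
    ((summable_geometric_of_lt_one (norm_nonneg _) hQ).mul_right _)
    (Eventually.of_forall fun n y hy => by
      rw [mem_ball_zero_iff] at hy
      rw [norm_neg, norm_mul, norm_pow]
      gcongr)
    (fun n => by fun_prop)
  have hd := h.differentiableOn (.of_forall fun _ => by
    simpa [Finset.prod_fn] using DifferentiableOn.finsetProd (fun _ _ => by fun_prop))
    Metric.isOpen_ball
  have := hd.differentiableAt (Metric.isOpen_ball.mem_nhds hx)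
  simpa [qPochhammer, sub_eq_add_neg] using! this

/-! ### The lattice and Liouville's theorem -/

lemma mem_lattice_periods {τ : UpperHalfPlane} {u : ℂ} :
    u ∈ (periods τ).lattice ↔ ∃ m n : ℤ, (m : ℂ) + n * (τ : ℂ) = u := by
  simp [PeriodPair.mem_lattice, periods]

lemma one_mem_lattice (τ : UpperHalfPlane) : (1 : ℂ) ∈ (periods τ).lattice :=
  (periods τ).ω₁_mem_lattice

lemma coe_mem_lattice (τ : UpperHalfPlane) : (τ : ℂ) ∈ (periods τ).lattice :=
  (periods τ).ω₂_mem_lattice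

/-- A function with the two periods of a lattice has all its elements as periods. -/
lemma periodic_lattice {τ : UpperHalfPlane} {α : Type*} {f : ℂ → α} (h₁ : ∀ u, f (u + 1) = f u)
    (h₂ : ∀ u, f (u + τ) = f u) {l : ℂ} (hl : l ∈ (periods τ).lattice) (u : ℂ) :
    f (u + l) = f u := by
  obtain ⟨m, n, rfl⟩ := mem_lattice_periods.1 hl
  have h₁' : Function.Periodic f 1 := h₁
  have h₂' : Function.Periodic f (τ : ℂ) := h₂
  have := (h₁'.int_mul m).add_period (h₂'.int_mul n) u
  simpa using this

/-- Liouville's theorem for elliptic functions with removable singularities only. -/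
lemma elliptic_eq_const {τ : UpperHalfPlane} {f : ℂ → ℂ} (h₁ : ∀ u, f (u + 1) = f u)
    (h₂ : ∀ u, f (u + τ) = f u)
    (hf : ∀ u₀, ∃ g, AnalyticAt ℂ g u₀ ∧ f =ᶠ[𝓝[≠] u₀] g) :
    ∃ C, ∀ u, ContinuousAt f u → f u = C := by
  choose g hg hfg using hf
  -- The value at u of the extension chosen at u is the punctured limit of f there. It does not
  -- depend on the choice, so the local extensions glue to one entire function.
  let F : ℂ → ℂ := fun u => g u u
  have hlim : ∀ u, Tendsto f (𝓝[≠] u) (𝓝 (F u)) := fun u =>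
    ((hg u).continuousAt.tendsto.mono_left nhdsWithin_le_nhds).congr' (hfg u).symm
  have hF : ∀ u₀, F =ᶠ[𝓝 u₀] g u₀ := by
    intro u₀
    have h1 : ∀ᶠ u in 𝓝[≠] u₀, F u = g u₀ u := by
      have ha := (hg u₀).eventually_analyticAt.filter_mono (nhdsWithin_le_nhds (s := {u₀}ᶜ))
      filter_upwards [eventually_eventually_nhdsWithin.2 (hfg u₀), ha, self_mem_nhdsWithin]
        with u hu hau hne
      have h2 : f =ᶠ[𝓝[≠] u] g u₀ := by
        rw [isOpen_compl_singleton.nhdsWithin_eq hne] at hu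
        exact hu.filter_mono nhdsWithin_le_nhds
      exact tendsto_nhds_unique (hlim u)
        ((hau.continuousAt.tendsto.mono_left nhdsWithin_le_nhds).congr' h2.symm)
    rw [eventually_nhdsWithin_iff] at h1
    filter_upwards [h1] with u hu
    by_cases h : u = u₀
    · subst h; rfl
    · exact hu h
  have hd : Differentiable ℂ F := fun u => ((hg u).congr (hF u).symm).differentiableAt
  have hper : ∀ l, (∀ u, f (u + l) = f u) → ∀ u, F (u + l) = F u := by
    intro l hl u
    have h3 : Tendsto (fun x => x + l) (𝓝[≠] u) (𝓝[≠] (u + l)) := by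
      refine tendsto_nhdsWithin_iff.2 ⟨?_, ?_⟩
      · exact (Continuous.tendsto (by fun_prop) u).mono_left nhdsWithin_le_nhds
      · filter_upwards [self_mem_nhdsWithin] with x hx
        simpa using hx
    exact tendsto_nhds_unique (((hlim (u + l)).comp h3).congr hl) (hlim u)
  -- A continuous function with a full lattice of periods has compact range, so Liouville's theorem
  -- applies to F.
  have hb := (IsZLattice.isCompact_range_of_periodic (periods τ).lattice F hd.continuous
    fun z w hw => periodic_lattice (hper 1 h₁) (hper τ h₂) hw z).isBounded
  refine ⟨F 0, fun u hu => ?_⟩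
  rw [← hd.apply_eq_apply_of_bounded hb u 0]
  exact tendsto_nhds_unique (hu.tendsto.mono_left nhdsWithin_le_nhds) (hlim u)

/-! ### The theta function: quasi-periodicity, parity, nonvanishing somewhere -/

lemma theta_eq_jacobiTheta₂ (τ : UpperHalfPlane) (u : ℂ) :
    theta τ u = -I * exp (Real.pi * I * τ / 4 + Real.pi * I * u)
      * jacobiTheta₂ (u + 1 / 2 + τ / 2) τ := by
  have h : jacobiTheta₂ (u + 1 / 2 + τ / 2) τ
      = ∑' k : ℤ, jacobiTheta₂_term k (u + 1 / 2 + τ / 2) τ := rfl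
  rw [theta, h, ← tsum_mul_left, ← tsum_mul_left]
  refine tsum_congr fun k => ?_
  rw [jacobiTheta₂_term, ← Complex.exp_pi_mul_I, ← Complex.exp_int_mul, ← Complex.exp_add,
    ← Complex.exp_add, mul_assoc (-I), ← Complex.exp_add]
  congr 2
  ring

lemma differentiable_theta (τ : UpperHalfPlane) : Differentiable ℂ (theta τ) := by
  have h : theta τ = fun u => -I * exp (Real.pi * I * τ / 4 + Real.pi * I * u)
      * jacobiTheta₂ (u + 1 / 2 + τ / 2) τ := funext (theta_eq_jacobiTheta₂ τ)
  intro u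
  rw [h]
  have h2 := (differentiableAt_jacobiTheta₂_fst (u + 1 / 2 + τ / 2) τ.im_pos).comp u
    (f := fun u : ℂ => u + 1 / 2 + τ / 2) (by fun_prop)
  exact DifferentiableAt.mul (by fun_prop) h2

lemma theta_add_one (τ : UpperHalfPlane) (u : ℂ) : theta τ (u + 1) = -theta τ u := by
  rw [theta_eq_jacobiTheta₂, theta_eq_jacobiTheta₂,
    show u + 1 + 1 / 2 + (τ : ℂ) / 2 = u + 1 / 2 + τ / 2 + 1 by ring, jacobiTheta₂_add_left,
    show (Real.pi * I * τ / 4 + Real.pi * I * (u + 1) : ℂ)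
      = Real.pi * I * τ / 4 + Real.pi * I * u + Real.pi * I by ring,
    Complex.exp_add _ (Real.pi * I : ℂ), Complex.exp_pi_mul_I]
  ring

lemma theta_add_coe (τ : UpperHalfPlane) (u : ℂ) :
    theta τ (u + τ) = -exp (-(Real.pi * I * τ) - 2 * Real.pi * I * u) * theta τ u := by
  rw [theta_eq_jacobiTheta₂, theta_eq_jacobiTheta₂,
    show u + τ + 1 / 2 + (τ : ℂ) / 2 = u + 1 / 2 + τ / 2 + τ by ring, jacobiTheta₂_add_left']
  have h : exp (Real.pi * I * τ / 4 + Real.pi * I * (u + τ))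
      * exp (-Real.pi * I * (τ + 2 * (u + 1 / 2 + τ / 2)))
      = -exp (-(Real.pi * I * τ) - 2 * Real.pi * I * u)
        * exp (Real.pi * I * τ / 4 + Real.pi * I * u) := by
    rw [← Complex.exp_add, neg_mul (exp _), ← Complex.exp_add, ← Complex.exp_sub_pi_mul_I]
    congr 1
    ring
  linear_combination (-I * jacobiTheta₂ (u + 1 / 2 + τ / 2) τ) * h

lemma theta_neg (τ : UpperHalfPlane) (u : ℂ) : theta τ (-u) = -theta τ u := by
  have h1 := jacobiTheta₂_add_left' (-u + 1 / 2 - τ / 2) τ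
  have h2 := jacobiTheta₂_add_left (-u - 1 / 2 - τ / 2) τ
  have h3 := jacobiTheta₂_neg_left (u + 1 / 2 + τ / 2) τ
  rw [show -u + 1 / 2 - (τ : ℂ) / 2 + τ = -u + 1 / 2 + τ / 2 by ring] at h1
  rw [show -u - 1 / 2 - (τ : ℂ) / 2 + 1 = -u + 1 / 2 - τ / 2 by ring] at h2
  rw [show -(u + 1 / 2 + (τ : ℂ) / 2) = -u - 1 / 2 - τ / 2 by ring] at h3
  rw [theta_eq_jacobiTheta₂, theta_eq_jacobiTheta₂, h1, h2, h3]
  have h : exp (Real.pi * I * τ / 4 + Real.pi * I * (-u))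
      * exp (-Real.pi * I * (τ + 2 * (-u + 1 / 2 - τ / 2)))
      = -exp (Real.pi * I * τ / 4 + Real.pi * I * u) := by
    rw [← Complex.exp_add, ← Complex.exp_sub_pi_mul_I]
    congr 1
    ring
  linear_combination (-I * jacobiTheta₂ (u + 1 / 2 + τ / 2) τ) * h

lemma theta_zero (τ : UpperHalfPlane) : theta τ 0 = 0 := by
  have := theta_neg τ 0
  rw [neg_zero] at this
  linear_combination this / 2

/-- The constant Fourier coefficient of the Jacobi theta function is `1`. -/
lemma integral_jacobiTheta₂ {τ : ℂ} (hτ : 0 < τ.im) :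
    ∫ x in (0 : ℝ)..1, jacobiTheta₂ x τ = 1 := by
  let f : ℤ → C(ℝ, ℂ) := fun n => ⟨fun x => jacobiTheta₂_term n x τ, by
    unfold jacobiTheta₂_term; fun_prop⟩
  have hs : Summable fun n => ‖(f n).restrict (⟨Set.uIcc 0 1, isCompact_uIcc⟩ :
      TopologicalSpace.Compacts ℝ)‖ := by
    -- For real x the norm of each term depends only on n and τ, so the series at 0 is a uniform
    -- majorant.
    refine Summable.of_nonneg_of_le (fun n => norm_nonneg _) (fun n => ?_)
      (((summable_jacobiTheta₂_term_iff 0 τ).2 hτ).norm)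
    refine (ContinuousMap.norm_le _ (norm_nonneg _)).2 fun x => ?_
    simp [f, norm_jacobiTheta₂_term]
  have h := intervalIntegral.hasSum_intervalIntegral_of_summable_norm (a := 0) (b := 1) hs
  have h0 : ∀ n : ℤ, n ≠ 0 → ∫ x in (0 : ℝ)..1, f n x = 0 := by
    intro n hn
    have hn' : (2 * Real.pi * I * n : ℂ) ≠ 0 := by simp [hn, Real.pi_ne_zero]
    have : ∀ x : ℝ, f n x = exp (Real.pi * I * n ^ 2 * τ) * exp (2 * Real.pi * I * n * x) := by
      intro x
      simp only [f, ContinuousMap.coe_mk, jacobiTheta₂_term]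
      rw [add_comm, Complex.exp_add]
    simp_rw [this]
    rw [intervalIntegral.integral_const_mul, integral_exp_mul_complex hn']
    have : exp (2 * Real.pi * I * n) = 1 := by
      rw [mul_comm]; exact Complex.exp_int_mul_two_pi_mul_I n
    simp [this]
  have h1 := hasSum_single (f := fun n => ∫ x in (0 : ℝ)..1, f n x) 0 h0
  have := h.unique h1
  simpa [f, jacobiTheta₂, jacobiTheta₂_term] using! this

/-- Otherwise `jacobiTheta₂` would vanish on the real line, against its constant Fourier coefficient
1. This excludes C = 0 when theta is compared with its product form. -/
lemma exists_theta_ne_zero (τ : UpperHalfPlane) : ∃ u, theta τ u ≠ 0 := by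
  by_contra! h
  have h0 : ∀ x : ℝ, jacobiTheta₂ x τ = 0 := by
    intro x
    have := h (x - 1 / 2 - τ / 2)
    rw [theta_eq_jacobiTheta₂] at this
    rw [show (x - 1 / 2 - τ / 2 + 1 / 2 + τ / 2 : ℂ) = x by ring] at this
    simpa [Complex.exp_ne_zero] using this
  have := integral_jacobiTheta₂ τ.im_pos
  simp [h0] at this

/-! ### The product form and the zeros of theta -/

/-- The product form of the theta function, up to a constant factor. -/
def thetaProd (τ : UpperHalfPlane) (u : ℂ) : ℂ :=
  exp (-(Real.pi * I * u)) * qPochhammer (exp (2 * Real.pi * I * τ)) (exp (2 * Real.pi * I * u))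
    * qPochhammer (exp (2 * Real.pi * I * τ))
      (exp (2 * Real.pi * I * τ) * exp (-(2 * Real.pi * I * u)))

lemma norm_exp_lt_one (τ : UpperHalfPlane) : ‖exp (2 * Real.pi * I * τ)‖ < 1 :=
  UpperHalfPlane.norm_exp_two_pi_I_lt_one τ

lemma thetaProd_add_one (τ : UpperHalfPlane) (u : ℂ) : thetaProd τ (u + 1) = -thetaProd τ u := by
  have h1 : exp (-(Real.pi * I * (u + 1))) = -exp (-(Real.pi * I * u)) := by
    rw [← Complex.exp_sub_pi_mul_I]; congr 1; ring
  have h2 : exp (2 * Real.pi * I * (u + 1)) = exp (2 * Real.pi * I * u) := by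
    rw [mul_add, mul_one, Complex.exp_add, Complex.exp_two_pi_mul_I, mul_one]
  have h3 : exp (-(2 * Real.pi * I * (u + 1))) = exp (-(2 * Real.pi * I * u)) := by
    rw [Complex.exp_neg, h2, Complex.exp_neg]
  simp only [thetaProd, h1, h2, h3]
  ring

lemma thetaProd_add_coe (τ : UpperHalfPlane) (u : ℂ) :
    thetaProd τ (u + τ) = -exp (-(Real.pi * I * τ) - 2 * Real.pi * I * u) * thetaProd τ u := by
  have hQ := norm_exp_lt_one τ
  have h1 : exp (-(Real.pi * I * (u + τ)))
      = exp (-(Real.pi * I * τ)) * exp (-(Real.pi * I * u)) := by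
    rw [← Complex.exp_add]; congr 1; ring
  have h2 : exp (2 * Real.pi * I * (u + τ))
      = exp (2 * Real.pi * I * τ) * exp (2 * Real.pi * I * u) := by
    rw [← Complex.exp_add]; congr 1; ring
  have h3 : exp (2 * Real.pi * I * τ) * exp (-(2 * Real.pi * I * (u + τ)))
      = exp (-(2 * Real.pi * I * u)) := by
    rw [← Complex.exp_add]; congr 1; ring
  have h4 : exp (2 * Real.pi * I * u) * exp (-(2 * Real.pi * I * u)) = 1 := by
    rw [← Complex.exp_add]; simp
  have h5 : exp (-(Real.pi * I * τ) - 2 * Real.pi * I * u)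
      = exp (-(Real.pi * I * τ)) * exp (-(2 * Real.pi * I * u)) := by
    rw [← Complex.exp_add]; congr 1
  have h6 := qPochhammer_eq_mul hQ (exp (2 * Real.pi * I * u))
  have h7 := qPochhammer_eq_mul hQ (exp (-(2 * Real.pi * I * u)))
  simp only [thetaProd, h1, h2, h3, h5]
  rw [h6, h7]
  generalize qPochhammer _ _ = A
  generalize qPochhammer _ _ = B
  linear_combination (-exp (-(Real.pi * I * τ)) * exp (-(Real.pi * I * u)) * A * B) * h4

lemma differentiable_thetaProd (τ : UpperHalfPlane) : Differentiable ℂ (thetaProd τ) := by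
  have h := differentiable_qPochhammer (norm_exp_lt_one τ)
  unfold thetaProd
  fun_prop

lemma thetaProd_ne_zero {τ : UpperHalfPlane} {u : ℂ} (hu : u ∉ (periods τ).lattice) :
    thetaProd τ u ≠ 0 := by
  have hQ := norm_exp_lt_one τ
  -- With Q = exp (2πiτ), a vanishing factor means Q^n e^{2πiu} = 1 or Q^(n+1) e^{−2πiu} = 1, and
  -- either forces u into the lattice.
  have key : ∀ (a b : ℤ), b = 1 ∨ b = -1 →
      exp (a * (2 * Real.pi * I * τ) + b * (2 * Real.pi * I * u)) ≠ 1 := by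
    intro a b hb h
    obtain ⟨n, hn⟩ := Complex.exp_eq_one_iff.1 h
    have h2 : (2 * Real.pi * I : ℂ) ≠ 0 := by simp [Real.pi_ne_zero]
    have h3 : (a * τ + b * u : ℂ) = n := by
      apply mul_left_cancel₀ h2
      linear_combination hn
    apply hu
    rcases hb with rfl | rfl
    · exact mem_lattice_periods.2 ⟨n, -a, by push_cast at *; linear_combination -h3⟩
    · exact mem_lattice_periods.2 ⟨-n, a, by push_cast at *; linear_combination h3⟩
  refine mul_ne_zero (mul_ne_zero (Complex.exp_ne_zero _) (qPochhammer_ne_zero hQ fun n => ?_))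
    (qPochhammer_ne_zero hQ fun n => ?_)
  · have := key n 1 (Or.inl rfl)
    rw [Complex.exp_add] at this
    simpa [← Complex.exp_nat_mul] using this
  · have := key (n + 1) (-1) (Or.inr rfl)
    rw [Complex.exp_add] at this
    simp only [← Complex.exp_nat_mul, ← Complex.exp_add] at *
    intro h; apply this; rw [← h]; congr 1; push_cast; ring

lemma thetaProd_zero (τ : UpperHalfPlane) : thetaProd τ 0 = 0 := by
  have := qPochhammer_eq_mul (norm_exp_lt_one τ) 1
  simp [thetaProd, this]

lemma deriv_thetaProd_zero_ne_zero (τ : UpperHalfPlane) : deriv (thetaProd τ) 0 ≠ 0 := by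
  have hQ := norm_exp_lt_one τ
  have hd := differentiable_qPochhammer hQ
  set Q := exp (2 * Real.pi * I * τ) with hQdef
  -- Splitting off the factor with n = 0 isolates the zero at the origin: 1 − e^{2πiu} vanishes
  -- simply there, and r does not vanish.
  let r : ℂ → ℂ := fun u => exp (-(Real.pi * I * u)) * qPochhammer Q (Q * exp (2 * Real.pi * I * u))
    * qPochhammer Q (Q * exp (-(2 * Real.pi * I * u)))
  have hr : Differentiable ℂ r := by fun_prop
  have h : thetaProd τ = fun u => (1 - exp (2 * Real.pi * I * u)) * r u := by
    funext u
    simp only [thetaProd, r, ← hQdef]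
    rw [qPochhammer_eq_mul hQ (exp (2 * Real.pi * I * u))]
    ring
  have h1 : HasDerivAt (fun u : ℂ => 1 - exp (2 * Real.pi * I * u)) (-(2 * Real.pi * I)) 0 := by
    have := (((hasDerivAt_id (0 : ℂ)).const_mul (2 * Real.pi * I : ℂ)).cexp).const_sub 1
    simpa using this
  have h2 := (h1.mul (hr 0).hasDerivAt).deriv
  have hne : qPochhammer Q Q ≠ 0 := by
    refine qPochhammer_ne_zero hQ fun n hn => ?_
    have h3 := congrArg norm hn
    rw [norm_mul, norm_pow, norm_one, ← pow_succ] at h3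
    exact (pow_lt_one₀ (norm_nonneg _) hQ (Nat.succ_ne_zero n)).ne h3
  rw [h]
  change deriv ((fun u : ℂ => 1 - exp (2 * Real.pi * I * u)) * r) 0 ≠ 0
  rw [h2]
  simp [r, hne, Real.pi_ne_zero]

/-- A function with a zero at the origin is `u * s u` with `s` analytic. -/
lemma exists_eq_mul_of_zero {f : ℂ → ℂ} (hf : AnalyticAt ℂ f 0) (h0 : f 0 = 0) :
    ∃ s : ℂ → ℂ, AnalyticAt ℂ s 0 ∧ s 0 = deriv f 0 ∧ ∀ u, f u = u * s u := by
  obtain ⟨p, hp⟩ := hf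
  refine ⟨dslope f 0, ⟨_, hp.has_fpower_series_dslope_fslope⟩, by simp, fun u => ?_⟩
  have := sub_smul_dslope f 0 u
  simpa [h0] using this.symm

/-- Removability of a singularity is invariant under translation by periods. -/
lemma eventuallyEq_analytic_translate {τ : UpperHalfPlane} {f : ℂ → ℂ}
    (h₁ : ∀ u, f (u + 1) = f u) (h₂ : ∀ u, f (u + τ) = f u) {a u₀ : ℂ}
    (ha : u₀ - a ∈ (periods τ).lattice)
    (hf : ∃ g, AnalyticAt ℂ g a ∧ f =ᶠ[𝓝[≠] a] g) :
    ∃ g, AnalyticAt ℂ g u₀ ∧ f =ᶠ[𝓝[≠] u₀] g := by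
  obtain ⟨g, hg, hfg⟩ := hf
  have hu : u₀ + (a - u₀) = a := by ring
  refine ⟨fun u => g (u + (a - u₀)), ?_, ?_⟩
  · exact AnalyticAt.comp (by rwa [hu]) (by fun_prop)
  · have h3 : Tendsto (fun x => x + (a - u₀)) (𝓝[≠] u₀) (𝓝[≠] a) := by
      refine tendsto_nhdsWithin_iff.2 ⟨?_, ?_⟩
      · have : Tendsto (fun x => x + (a - u₀)) (𝓝 u₀) (𝓝 (u₀ + (a - u₀))) :=
          Continuous.tendsto (by fun_prop) u₀
        rw [hu] at this
        exact this.mono_left nhdsWithin_le_nhds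
      · filter_upwards [self_mem_nhdsWithin] with x hx h
        apply hx
        simp only [Set.mem_singleton_iff] at *
        linear_combination h
    filter_upwards [h3.eventually hfg] with x hx
    rw [← hx]
    have hm := (periods τ).lattice.neg_mem ha
    rw [neg_sub] at hm
    exact (periodic_lattice h₁ h₂ hm x).symm

lemma countable_lattice (τ : UpperHalfPlane) : ((periods τ).lattice : Set ℂ).Countable :=
  ((periods τ).latticeEquivProd.toEquiv.countable_iff.2 inferInstance : Countable _).to_set

/-- The theta function is a nonzero multiple of its product form. -/
lemma exists_theta_eq_const_mul (τ : UpperHalfPlane) :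
    ∃ C : ℂ, C ≠ 0 ∧ ∀ u, theta τ u = C * thetaProd τ u := by
  have hp₁ : ∀ u, theta τ (u + 1) / thetaProd τ (u + 1) = theta τ u / thetaProd τ u := by
    intro u
    rw [theta_add_one, thetaProd_add_one, neg_div_neg_eq]
  have hp₂ : ∀ u, theta τ (u + τ) / thetaProd τ (u + τ) = theta τ u / thetaProd τ u := by
    intro u
    rw [theta_add_coe, thetaProd_add_coe, mul_div_mul_left _ _
      (neg_ne_zero.2 (Complex.exp_ne_zero _))]
  have hat := fun u => (differentiable_theta τ).analyticAt u
  have hap := fun u => (differentiable_thetaProd τ).analyticAt u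
  obtain ⟨C, hC⟩ := elliptic_eq_const (f := fun u => theta τ u / thetaProd τ u) hp₁ hp₂ (by
    intro u₀
    by_cases hu : u₀ ∈ (periods τ).lattice
    · refine eventuallyEq_analytic_translate hp₁ hp₂ (a := 0) (by simpa using hu) ?_
      obtain ⟨s, hs, hs0, hs'⟩ := exists_eq_mul_of_zero (hat 0) (theta_zero τ)
      obtain ⟨r, hr, hr0, hr'⟩ := exists_eq_mul_of_zero (hap 0) (thetaProd_zero τ)
      -- Only the zero of the denominator has to be known to be simple; for the numerator, vanishing
      -- at 0 is enough.
      refine ⟨fun u => s u / r u, hs.div hr (hr0 ▸ deriv_thetaProd_zero_ne_zero τ), ?_⟩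
      filter_upwards [self_mem_nhdsWithin] with u hu
      rw [hs', hr', mul_div_mul_left _ _ hu]
    · exact ⟨_, (hat u₀).div (hap u₀) (thetaProd_ne_zero hu), EventuallyEq.rfl⟩)
  have hoff : Set.EqOn (theta τ) (fun u => C * thetaProd τ u) ((periods τ).lattice : Set ℂ)ᶜ := by
    intro u hu
    have hne := thetaProd_ne_zero hu
    have := hC u ((hat u).div (hap u) hne).continuousAt
    exact (div_eq_iff hne).1 this
  have hdense : Dense ((periods τ).lattice : Set ℂ)ᶜ :=
    (countable_lattice τ).dense_compl ℝ
  have hall := Continuous.ext_on hdense (differentiable_theta τ).continuous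
    (continuous_const.mul (differentiable_thetaProd τ).continuous) hoff
  refine ⟨C, ?_, fun u => congrFun hall u⟩
  rintro rfl
  obtain ⟨u, hu⟩ := exists_theta_ne_zero τ
  exact hu (by simpa using congrFun hall u)

lemma theta_ne_zero {τ : UpperHalfPlane} {u : ℂ} (hu : u ∉ (periods τ).lattice) :
    theta τ u ≠ 0 := by
  obtain ⟨C, hC, h⟩ := exists_theta_eq_const_mul τ
  rw [h]
  exact mul_ne_zero hC (thetaProd_ne_zero hu)

lemma deriv_theta_zero_ne_zero (τ : UpperHalfPlane) : deriv (theta τ) 0 ≠ 0 := by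
  obtain ⟨C, hC, h⟩ := exists_theta_eq_const_mul τ
  rw [show theta τ = fun u => C * thetaProd τ u from funext h,
    deriv_const_mul C (differentiable_thetaProd τ 0)]
  exact mul_ne_zero hC (deriv_thetaProd_zero_ne_zero τ)

/-! ### The Kronecker function -/

lemma kronecker_add_one (τ : UpperHalfPlane) (x u : ℂ) :
    kronecker τ x (u + 1) = kronecker τ x u := by
  rw [kronecker, kronecker, ← add_assoc, theta_add_one, theta_add_one, mul_neg, mul_neg,
    neg_div_neg_eq]

lemma kronecker_add_coe (τ : UpperHalfPlane) (x u : ℂ) :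
    kronecker τ x (u + τ) = exp (-(2 * Real.pi * I * x)) * kronecker τ x u := by
  have h : exp (-(Real.pi * I * τ) - 2 * Real.pi * I * (x + u))
      = exp (-(2 * Real.pi * I * x)) * exp (-(Real.pi * I * τ) - 2 * Real.pi * I * u) := by
    rw [← Complex.exp_add]; congr 1; ring
  have hne := Complex.exp_ne_zero (-(Real.pi * I * τ) - 2 * Real.pi * I * u)
  rw [kronecker, kronecker, ← add_assoc, theta_add_coe, theta_add_coe, h]
  rw [show ∀ d e c t₁ t₂ t₃ : ℂ, d * (-(e * c) * t₁) / (t₂ * (-c * t₃))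
    = (-c * (e * (d * t₁))) / (-c * (t₂ * t₃)) by intros; congr 1 <;> ring,
    mul_div_mul_left _ _ (neg_ne_zero.2 hne), mul_div_assoc]

lemma analyticAt_kronecker {τ : UpperHalfPlane} (x : ℂ) {u : ℂ} (hu : u ∉ (periods τ).lattice) :
    AnalyticAt ℂ (kronecker τ x) u := by
  have hat := fun w => (differentiable_theta τ).analyticAt w
  have h : kronecker τ x = fun u =>
      deriv (theta τ) 0 * theta τ (x + u) / theta τ x / theta τ u := by
    funext u
    rw [kronecker, div_div]
  rw [h]
  have h1 : AnalyticAt ℂ (fun u => theta τ (x + u)) u := (hat (x + u)).comp (by fun_prop)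
  exact ((analyticAt_const.mul h1).div_const).div (hat u) (theta_ne_zero hu)

/-- The Kronecker function has a simple pole with residue `1` at the origin. -/
lemma exists_kronecker_eq_div {τ : UpperHalfPlane} {x : ℂ} (hx : x ∉ (periods τ).lattice) :
    ∃ k : ℂ → ℂ, AnalyticAt ℂ k 0 ∧ k 0 = 1 ∧ ∀ u, kronecker τ x u = k u / u := by
  have hat := fun w => (differentiable_theta τ).analyticAt w
  obtain ⟨s, hs, hs0, hs'⟩ := exists_eq_mul_of_zero (hat 0) (theta_zero τ)
  have hd := deriv_theta_zero_ne_zero τ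
  have hx0 := theta_ne_zero hx
  have h1 : AnalyticAt ℂ (fun u => theta τ (x + u)) 0 := (hat (x + 0)).comp (by fun_prop)
  refine ⟨fun u => deriv (theta τ) 0 * theta τ (x + u) / (theta τ x * s u), ?_, ?_, fun u => ?_⟩
  · exact (analyticAt_const.mul h1).div (analyticAt_const.mul hs) (mul_ne_zero hx0 (hs0 ▸ hd))
  · simp only [hs0, add_zero]
    field_simp
  · rw [kronecker, hs' u, div_div]
    congr 1
    ring

lemma add_mem_lattice_iff {τ : UpperHalfPlane} {l : ℂ} (hl : l ∈ (periods τ).lattice) (u : ℂ) :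
    u + l ∈ (periods τ).lattice ↔ u ∈ (periods τ).lattice :=
  ⟨fun h => by simpa using sub_mem h hl, fun h => add_mem h hl⟩

lemma weierstrassP_add_one (τ : UpperHalfPlane) (u : ℂ) :
    (periods τ).weierstrassP (u + 1) = (periods τ).weierstrassP u :=
  (periods τ).weierstrassP_add_coe u ⟨1, one_mem_lattice τ⟩

lemma weierstrassP_add_coe (τ : UpperHalfPlane) (u : ℂ) :
    (periods τ).weierstrassP (u + τ) = (periods τ).weierstrassP u :=
  (periods τ).weierstrassP_add_coe u ⟨τ, coe_mem_lattice τ⟩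

lemma kronecker_sub_one (τ : UpperHalfPlane) (x u : ℂ) :
    kronecker τ x (u - 1) = kronecker τ x u := by
  rw [← kronecker_add_one, sub_add_cancel]

lemma kronecker_sub_coe (τ : UpperHalfPlane) (x u : ℂ) :
    kronecker τ x (u - τ) = exp (2 * Real.pi * I * x) * kronecker τ x u := by
  have h := kronecker_add_coe τ x (u - τ)
  rw [sub_add_cancel] at h
  rw [h, ← mul_assoc, ← Complex.exp_add]
  simp

/-- `φ(x, y) φ(x, -y) + ℘(y)` does not depend on `y`. -/
lemma kronecker_mul_kronecker_neg {τ : UpperHalfPlane} {x : ℂ} (hx : x ∉ (periods τ).lattice) :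
    ∃ C, ∀ y ∉ (periods τ).lattice,
      kronecker τ x y * kronecker τ x (-y) + (periods τ).weierstrassP y = C := by
  have hp₁ : ∀ u, kronecker τ x (u + 1) * kronecker τ x (-(u + 1))
      + (periods τ).weierstrassP (u + 1)
      = kronecker τ x u * kronecker τ x (-u) + (periods τ).weierstrassP u := by
    intro u
    rw [kronecker_add_one, neg_add, ← sub_eq_add_neg, kronecker_sub_one, weierstrassP_add_one]
  have hp₂ : ∀ u, kronecker τ x (u + τ) * kronecker τ x (-(u + τ))
      + (periods τ).weierstrassP (u + τ)
      = kronecker τ x u * kronecker τ x (-u) + (periods τ).weierstrassP u := by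
    intro u
    have h : exp (-(2 * Real.pi * I * x)) * exp (2 * Real.pi * I * x) = 1 := by
      rw [← Complex.exp_add]; simp
    rw [kronecker_add_coe, neg_add, ← sub_eq_add_neg, kronecker_sub_coe, weierstrassP_add_coe]
    linear_combination (kronecker τ x u * kronecker τ x (-u)) * h
  have hreg : ∀ u ∉ (periods τ).lattice, AnalyticAt ℂ (fun y => kronecker τ x y * kronecker τ x (-y)
      + (periods τ).weierstrassP y) u := by
    intro u hu
    have hu' : -u ∉ (periods τ).lattice := by rwa [neg_mem_iff]
    exact ((analyticAt_kronecker x hu).mul ((analyticAt_kronecker x hu').comp (by fun_prop))).add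
      ((periods τ).analyticOnNhd_weierstrassP u hu)
  obtain ⟨C, hC⟩ := elliptic_eq_const (f := fun u => kronecker τ x u * kronecker τ x (-u)
      + (periods τ).weierstrassP u) hp₁ hp₂ (by
    intro u₀
    by_cases hu : u₀ ∈ (periods τ).lattice
    · refine eventuallyEq_analytic_translate (f := fun u => kronecker τ x u * kronecker τ x (-u)
        + (periods τ).weierstrassP u) hp₁ hp₂ (a := 0) (by simpa using hu) ?_
      obtain ⟨k, hk, hk0, hk'⟩ := exists_kronecker_eq_div hx
      have hkn : AnalyticAt ℂ (fun y => k (-y)) 0 :=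
        AnalyticAt.comp (by simpa using hk) (by fun_prop)
      -- Near 0, φ(x,y) φ(x,−y) = −k(y) k(−y) / y² and ℘(y) is 1/y² plus a regular function, so the
      -- singular part of the sum is h(y)/y². Since h is even and h(0) = 0, it vanishes to second
      -- order.
      let h : ℂ → ℂ := fun y => 1 - k y * k (-y)
      have hh : AnalyticAt ℂ h 0 := analyticAt_const.sub (hk.mul hkn)
      have hd : deriv h 0 = 0 := by
        have h1 := deriv_comp_neg h 0
        have h2 : (fun y => h (-y)) = h := by
          funext y
          simp only [h, neg_neg]
          ring
        rw [h2, neg_zero] at h1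
        linear_combination h1 / 2
      obtain ⟨s, hs, hs0, hs'⟩ := exists_eq_mul_of_zero hh (by simp [h, hk0])
      obtain ⟨r, hr, hr0, hr'⟩ := exists_eq_mul_of_zero hs (hs0.trans hd)
      refine ⟨fun y => r y + (periods τ).weierstrassPExcept 0 y,
        hr.add ((periods τ).analyticAt_weierstrassPExcept 0), ?_⟩
      filter_upwards [self_mem_nhdsWithin] with y hy
      have hy0 : y ≠ 0 := hy
      have h3 := (periods τ).weierstrassPExcept_add 0 y
      have h4 := hs' y
      rw [hr'] at h4
      simp only [h] at h4
      simp only [ZeroMemClass.coe_zero, sub_zero] at h3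
      rw [hk', hk', ← h3]
      field_simp
      linear_combination h4
    · exact ⟨_, hreg u₀ hu, EventuallyEq.rfl⟩)
  exact ⟨C, fun y hy => hC y (hreg y hy).continuousAt⟩

/-! ### Half-periods -/

lemma two_mul_halfPeriod_mem (τ : UpperHalfPlane) (a : Fin 4) :
    2 * halfPeriod τ a ∈ (periods τ).lattice := by
  have h1 := one_mem_lattice τ
  have h2 := coe_mem_lattice τ
  fin_cases a
  · simp [halfPeriod]
  · simpa [halfPeriod] using h1
  · have : 2 * ((1 + (τ : ℂ)) / 2) = 1 + τ := by ring
    simpa [halfPeriod, this] using add_mem h1 h2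
  · have : 2 * ((τ : ℂ) / 2) = τ := by ring
    simpa [halfPeriod, this] using h2

lemma neg_add_halfPeriod_mem_iff {τ : UpperHalfPlane} {a : Fin 4} {u : ℂ} :
    -u + halfPeriod τ a ∈ (periods τ).lattice ↔ u + halfPeriod τ a ∈ (periods τ).lattice := by
  rw [show -u + halfPeriod τ a = -(u + halfPeriod τ a) + 2 * halfPeriod τ a by ring,
    add_mem_lattice_iff (two_mul_halfPeriod_mem τ a), neg_mem_iff]

lemma lattice_coord_eq {τ : UpperHalfPlane} {r s : ℝ}
    (h : (r : ℂ) + s * (τ : ℂ) ∈ (periods τ).lattice) : (∃ m : ℤ, r = m) ∧ ∃ n : ℤ, s = n := by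
  obtain ⟨m, n, hmn⟩ := mem_lattice_periods.1 h
  have h1 := congrArg Complex.im hmn
  have h2 := congrArg Complex.re hmn
  simp at h1 h2
  have h3 : s = n := by
    rcases h1 with h | h
    · exact h.symm
    · exact absurd h τ.im_ne_zero
  subst h3
  exact ⟨⟨m, by linarith⟩, ⟨n, rfl⟩⟩

/-- In the real basis (1, τ) the difference has a coordinate ±1/2, whereas lattice points have
integer coordinates. -/
lemma sub_halfPeriod_notMem {τ : UpperHalfPlane} {a b : Fin 4} (hab : a ≠ b) :
    halfPeriod τ a - halfPeriod τ b ∉ (periods τ).lattice := by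
  have key : ∃ r s : ℝ, halfPeriod τ a - halfPeriod τ b = (r : ℂ) + s * (τ : ℂ) ∧
      ((r = 1 / 2 ∨ r = -1 / 2) ∨ (s = 1 / 2 ∨ s = -1 / 2)) := by
    refine ⟨(![0, 1 / 2, 1 / 2, 0] a - ![0, 1 / 2, 1 / 2, 0] b : ℝ),
      (![0, 0, 1 / 2, 1 / 2] a - ![0, 0, 1 / 2, 1 / 2] b : ℝ), ?_, ?_⟩
    · fin_cases a <;> fin_cases b <;> simp [halfPeriod] <;> ring
    · fin_cases a <;> fin_cases b <;> simp at hab ⊢ <;> norm_num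
  obtain ⟨r, s, h, hrs⟩ := key
  rw [h]
  intro hm
  obtain ⟨⟨m, hm⟩, ⟨n, hn⟩⟩ := lattice_coord_eq hm
  have hint : ∀ (j : ℤ) (t : ℝ), t = j → ¬ (t = 1 / 2 ∨ t = -1 / 2) := by
    rintro j t rfl (h | h)
    · have : (2 * j : ℝ) = 1 := by linarith
      norm_cast at this
      omega
    · have : (2 * j : ℝ) = -1 := by linarith
      norm_cast at this
      omega
  exact hrs.elim (hint m r hm) (hint n s hn)

lemma kronecker_add_two_mul_halfPeriod (τ : UpperHalfPlane) (x u : ℂ) (a : Fin 4) :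
    kronecker τ x (u + 2 * halfPeriod τ a)
      = exp (-(4 * Real.pi * I * x * halfPeriodDeriv a)) * kronecker τ x u := by
  have h : exp (-(4 * Real.pi * I * x * (1 / 2))) = exp (-(2 * Real.pi * I * x)) := by
    congr 1; ring
  fin_cases a
  · simp [halfPeriod, halfPeriodDeriv]
  · have : u + 2 * (1 / 2 : ℂ) = u + 1 := by ring
    simp only [halfPeriod, halfPeriodDeriv, Fin.mk_one, Matrix.cons_val_one, Matrix.cons_val_zero,
      this, kronecker_add_one]
    simp
  · have : u + 2 * ((1 + (τ : ℂ)) / 2) = u + 1 + τ := by ring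
    simp only [halfPeriod, halfPeriodDeriv, Fin.reduceFinMk, Matrix.cons_val,
      this, kronecker_add_one, kronecker_add_coe, h]
  · have : u + 2 * ((τ : ℂ) / 2) = u + τ := by ring
    simp only [halfPeriod, halfPeriodDeriv, Fin.reduceFinMk, Matrix.cons_val,
      this, kronecker_add_coe, h]

/-! ### The terms of v and their symmetrized products -/

/-- The terms of `v`. -/
def vTerm (τ : UpperHalfPlane) (z : ℂ) (a : Fin 4) (u : ℂ) : ℂ :=
  exp (4 * Real.pi * I * z * halfPeriodDeriv a) * kronecker τ (2 * z) (u + halfPeriod τ a)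

lemma v_eq_sum (τ : UpperHalfPlane) (ν : Fin 4 → ℂ) (z u : ℂ) :
    v τ ν z u = ∑ a, ν a * vTerm τ z a u :=
  Finset.sum_congr rfl fun a _ => by rw [vTerm, mul_assoc]

lemma vTerm_add_one (τ : UpperHalfPlane) (z : ℂ) (a : Fin 4) (u : ℂ) :
    vTerm τ z a (u + 1) = vTerm τ z a u := by
  rw [vTerm, vTerm, add_right_comm, kronecker_add_one]

lemma vTerm_add_coe (τ : UpperHalfPlane) (z : ℂ) (a : Fin 4) (u : ℂ) :
    vTerm τ z a (u + τ) = exp (-(4 * Real.pi * I * z)) * vTerm τ z a u := by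
  rw [vTerm, vTerm, add_right_comm, kronecker_add_coe, mul_left_comm]
  congr 3
  ring

lemma vTerm_sub_one (τ : UpperHalfPlane) (z : ℂ) (a : Fin 4) (u : ℂ) :
    vTerm τ z a (u - 1) = vTerm τ z a u := by
  rw [← vTerm_add_one, sub_add_cancel]

lemma vTerm_sub_coe (τ : UpperHalfPlane) (z : ℂ) (a : Fin 4) (u : ℂ) :
    vTerm τ z a (u - τ) = exp (4 * Real.pi * I * z) * vTerm τ z a u := by
  have h := vTerm_add_coe τ z a (u - τ)
  rw [sub_add_cancel] at h
  rw [h, ← mul_assoc, ← Complex.exp_add]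
  simp

lemma vTerm_add_two_mul_halfPeriod (τ : UpperHalfPlane) (z : ℂ) (a b : Fin 4) (u : ℂ) :
    vTerm τ z b (u + 2 * halfPeriod τ a)
      = exp (-(8 * Real.pi * I * z * halfPeriodDeriv a)) * vTerm τ z b u := by
  rw [vTerm, vTerm, add_right_comm, kronecker_add_two_mul_halfPeriod, mul_left_comm]
  congr 3
  ring

/-- Moving from −ωₐ to ωₐ costs a multiplier that turns the exponential prefactor into its inverse.
The Kronecker functions of the a-th term at u and −u thus have opposite arguments. -/
lemma vTerm_neg (τ : UpperHalfPlane) (z : ℂ) (a : Fin 4) (u : ℂ) :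
    vTerm τ z a (-u) = exp (-(4 * Real.pi * I * z * halfPeriodDeriv a))
      * kronecker τ (2 * z) (-(u + halfPeriod τ a)) := by
  rw [vTerm, show -u + halfPeriod τ a = -(u + halfPeriod τ a) + 2 * halfPeriod τ a by ring,
    kronecker_add_two_mul_halfPeriod, ← mul_assoc, ← Complex.exp_add]
  congr 2
  ring

lemma analyticAt_vTerm {τ : UpperHalfPlane} (z : ℂ) {a : Fin 4} {u : ℂ}
    (hu : u + halfPeriod τ a ∉ (periods τ).lattice) : AnalyticAt ℂ (vTerm τ z a) u :=
  analyticAt_const.mul ((analyticAt_kronecker (2 * z) hu).comp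
    (f := fun u => u + halfPeriod τ a) (by fun_prop))

lemma analyticAt_vTerm_neg {τ : UpperHalfPlane} (z : ℂ) {a : Fin 4} {u : ℂ}
    (hu : u + halfPeriod τ a ∉ (periods τ).lattice) :
    AnalyticAt ℂ (fun u => vTerm τ z a (-u)) u :=
  AnalyticAt.comp (g := vTerm τ z a) (analyticAt_vTerm z (neg_add_halfPeriod_mem_iff.not.2 hu))
    (by fun_prop)

/-- The poles of distinct terms cancel in the symmetrized product. -/
lemma vTerm_symm_removable {τ : UpperHalfPlane} {z : ℂ} (hz : 2 * z ∉ (periods τ).lattice)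
    {a b : Fin 4} (hab : a ≠ b) :
    ∃ g, AnalyticAt ℂ g (-halfPeriod τ a) ∧
      (fun u => vTerm τ z a u * vTerm τ z b (-u) + vTerm τ z a (-u) * vTerm τ z b u)
        =ᶠ[𝓝[≠] (-halfPeriod τ a)] g := by
  obtain ⟨k, hk, hk0, hk'⟩ := exists_kronecker_eq_div hz
  set e := exp (4 * Real.pi * I * z * halfPeriodDeriv a) with he
  set e' := exp (-(4 * Real.pi * I * z * halfPeriodDeriv a)) with he'
  have hb : -halfPeriod τ a + halfPeriod τ b ∉ (periods τ).lattice := by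
    rw [neg_add_eq_sub]
    exact sub_halfPeriod_notMem hab.symm
  -- This is y times the symmetrized product at u = y − ωₐ, so n(0) = 0 says that the residue at −ωₐ
  -- vanishes.
  let n : ℂ → ℂ := fun y => e * k y * vTerm τ z b (-(y - halfPeriod τ a))
    - e' * k (-y) * vTerm τ z b (y - halfPeriod τ a)
  have hn : AnalyticAt ℂ n 0 := by
    have h1 : AnalyticAt ℂ (fun y => k (-y)) 0 :=
      AnalyticAt.comp (by simpa using hk) (by fun_prop)
    have h2 : AnalyticAt ℂ (fun y => vTerm τ z b (y - halfPeriod τ a)) 0 :=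
      AnalyticAt.comp (g := vTerm τ z b) (f := fun y => y - halfPeriod τ a)
        (by simpa using analyticAt_vTerm z hb) (by fun_prop)
    have h3 : AnalyticAt ℂ (fun y => vTerm τ z b (-(y - halfPeriod τ a))) 0 :=
      AnalyticAt.comp (g := fun u => vTerm τ z b (-u)) (f := fun y => y - halfPeriod τ a)
        (by simpa using analyticAt_vTerm_neg z hb) (by fun_prop)
    exact ((analyticAt_const.mul hk).mul h3).sub ((analyticAt_const.mul h1).mul h2)
  -- The b-th term at ωₐ and at −ωₐ differs by the multiplier of the period 2ωₐ, which is exactly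
  -- e'/e.
  have hn0 : n 0 = 0 := by
    have h1 := vTerm_add_two_mul_halfPeriod τ z a b (-halfPeriod τ a)
    rw [show -halfPeriod τ a + 2 * halfPeriod τ a = halfPeriod τ a by ring] at h1
    have h2 : e * exp (-(8 * Real.pi * I * z * halfPeriodDeriv a)) = e' := by
      rw [he, he', ← Complex.exp_add]; congr 1; ring
    simp only [n, zero_sub, neg_neg, neg_zero, hk0, h1]
    linear_combination vTerm τ z b (-halfPeriod τ a) * h2
  obtain ⟨s, hs, -, hs'⟩ := exists_eq_mul_of_zero hn hn0
  refine ⟨fun u => s (u + halfPeriod τ a), AnalyticAt.comp (by simpa using hs) (by fun_prop), ?_⟩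
  filter_upwards [self_mem_nhdsWithin] with u hu
  have hy : u + halfPeriod τ a ≠ 0 := fun h => hu (eq_neg_of_add_eq_zero_left h)
  have h1 := hs' (u + halfPeriod τ a)
  simp only [n, add_sub_cancel_right] at h1
  rw [vTerm_neg τ z a, vTerm.eq_1 τ z a, hk', hk', ← he, ← he', eq_comm, ← mul_right_inj' hy, ← h1]
  field_simp
  ring

/-- The symmetrized products of two terms are constant, up to `℘` for equal terms. -/
lemma vTerm_symm_eq_const {τ : UpperHalfPlane} {z : ℂ} (hz : 2 * z ∉ (periods τ).lattice)
    (a b : Fin 4) :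
    ∃ C, ∀ u, u + halfPeriod τ a ∉ (periods τ).lattice → u + halfPeriod τ b ∉ (periods τ).lattice →
      vTerm τ z a u * vTerm τ z b (-u) + vTerm τ z a (-u) * vTerm τ z b u
        + (if a = b then 2 * (periods τ).weierstrassP (u + halfPeriod τ a) else 0) = C := by
  rcases eq_or_ne a b with rfl | hab
  · obtain ⟨C, hC⟩ := kronecker_mul_kronecker_neg hz
    refine ⟨2 * C, fun u hu _ => ?_⟩
    have h : exp (4 * Real.pi * I * z * halfPeriodDeriv a)
        * exp (-(4 * Real.pi * I * z * halfPeriodDeriv a)) = 1 := by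
      rw [← Complex.exp_add]; simp
    rw [← hC _ hu, vTerm_neg, vTerm, if_pos rfl]
    linear_combination (2 * kronecker τ (2 * z) (u + halfPeriod τ a)
      * kronecker τ (2 * z) (-(u + halfPeriod τ a))) * h
  · set f : ℂ → ℂ := fun u =>
      vTerm τ z a u * vTerm τ z b (-u) + vTerm τ z a (-u) * vTerm τ z b u with hf
    have hp₁ : ∀ u, f (u + 1) = f u := by
      intro u
      simp only [hf, neg_add, ← sub_eq_add_neg, vTerm_add_one, vTerm_sub_one]
    have hp₂ : ∀ u, f (u + τ) = f u := by
      intro u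
      -- The factors in u and in −u have inverse multipliers under the period τ, so their product is
      -- elliptic.
      have h : exp (-(4 * Real.pi * I * z)) * exp (4 * Real.pi * I * z) = 1 := by
        rw [← Complex.exp_add]; simp
      simp only [hf, neg_add, ← sub_eq_add_neg, vTerm_add_coe, vTerm_sub_coe]
      linear_combination (vTerm τ z a u * vTerm τ z b (-u) + vTerm τ z a (-u) * vTerm τ z b u) * h
    have hreg : ∀ u, u + halfPeriod τ a ∉ (periods τ).lattice →
        u + halfPeriod τ b ∉ (periods τ).lattice → AnalyticAt ℂ f u := fun u hua hub =>
      ((analyticAt_vTerm z hua).mul (analyticAt_vTerm_neg z hub)).add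
        ((analyticAt_vTerm_neg z hua).mul (analyticAt_vTerm z hub))
    obtain ⟨C, hC⟩ := elliptic_eq_const hp₁ hp₂ (by
      intro u₀
      by_cases hua : u₀ + halfPeriod τ a ∈ (periods τ).lattice
      · exact eventuallyEq_analytic_translate hp₁ hp₂ (by simpa using hua)
          (vTerm_symm_removable hz hab)
      by_cases hub : u₀ + halfPeriod τ b ∈ (periods τ).lattice
      · refine eventuallyEq_analytic_translate hp₁ hp₂ (a := -halfPeriod τ b)
          (by simpa using hub) ?_
        obtain ⟨g, hg, hgf⟩ := vTerm_symm_removable hz hab.symm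
        refine ⟨g, hg, ?_⟩
        filter_upwards [hgf] with u hu
        rw [← hu]
        simp only [hf]
        ring
      · exact ⟨f, hreg u₀ hua hub, EventuallyEq.rfl⟩)
    refine ⟨C, fun u hua hub => ?_⟩
    rw [if_neg hab, add_zero]
    exact hC u (hreg u hua hub).continuousAt

/-! ### The function v on its regular set -/

/-- The points at which no term of `v` with a nonzero coefficient has a pole. -/
def regularSet (τ : UpperHalfPlane) (ν νbar : Fin 4 → ℂ) : Set ℂ :=
  {u | ∀ a, (ν a ≠ 0 ∨ νbar a ≠ 0) → u + halfPeriod τ a ∉ (periods τ).lattice}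

section

variable {τ : UpperHalfPlane} {ν νbar : Fin 4 → ℂ}

lemma isOpen_regularSet : IsOpen (regularSet τ ν νbar) := by
  simp only [regularSet, Set.ofPred_forall]
  refine isOpen_iInter_of_finite fun a => isOpen_iInter_of_finite fun _ => ?_
  exact (periods τ).isClosed_lattice.isOpen_compl.preimage
    (f := fun u => u + halfPeriod τ a) (by fun_prop)

lemma countable_compl_regularSet : (regularSet τ ν νbar)ᶜ.Countable := by
  have h : (regularSet τ ν νbar)ᶜ ⊆
      ⋃ a, (fun u => u + halfPeriod τ a) ⁻¹' ((periods τ).lattice : Set ℂ) := by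
    intro u hu
    simp only [regularSet, Set.mem_compl_iff, Set.mem_ofPred_eq, not_forall, not_not] at hu
    obtain ⟨a, -, ha⟩ := hu
    exact Set.mem_iUnion.2 ⟨a, ha⟩
  exact (Set.countable_iUnion fun a =>
    (countable_lattice τ).preimage_of_injOn (add_left_injective _).injOn).mono h

lemma isPreconnected_regularSet : IsPreconnected (regularSet τ ν νbar) := by
  have h := countable_compl_regularSet (τ := τ) (ν := ν) (νbar := νbar)
  simpa using (h.isConnected_compl_of_one_lt_rank (by simp [rank_real_complex])).isPreconnected

lemma neg_mem_regularSet {u : ℂ} : -u ∈ regularSet τ ν νbar ↔ u ∈ regularSet τ ν νbar := by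
  simp only [regularSet, Set.mem_ofPred_eq, neg_add_halfPeriod_mem_iff]

lemma add_coe_mem_regularSet {u : ℂ} :
    u + τ ∈ regularSet τ ν νbar ↔ u ∈ regularSet τ ν νbar := by
  simp only [regularSet, Set.mem_ofPred_eq, add_right_comm u (τ : ℂ),
    add_mem_lattice_iff (coe_mem_lattice τ)]

lemma regularSet_swap : regularSet τ ν νbar = regularSet τ νbar ν := by
  simp only [regularSet, or_comm]

lemma regularSet_subset_self : regularSet τ ν νbar ⊆ regularSet τ ν ν :=
  fun _ hu a ha => hu a (Or.inl (ha.elim id id))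

lemma analyticAt_v (z : ℂ) {u : ℂ} (hu : u ∈ regularSet τ ν νbar) :
    AnalyticAt ℂ (fun u => v τ ν z u) u := by
  simp only [v_eq_sum]
  refine Finset.analyticAt_fun_sum _ fun a _ => ?_
  by_cases ha : ν a = 0
  · simpa [ha] using analyticAt_const
  · exact analyticAt_const.mul (analyticAt_vTerm z (hu a (Or.inl ha)))

lemma hasDerivAt_v (z : ℂ) {u : ℂ} (hu : u ∈ regularSet τ ν νbar) :
    HasDerivAt (fun u => v τ ν z u) (v' τ ν z u) u :=
  (analyticAt_v z hu).differentiableAt.hasDerivAt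

lemma hasDerivAt_v_neg (z : ℂ) {u : ℂ} (hu : u ∈ regularSet τ ν νbar) :
    HasDerivAt (fun u => v τ ν z (-u)) (-v' τ ν z (-u)) u := by
  have := (hasDerivAt_v z (neg_mem_regularSet.2 hu)).comp u (hasDerivAt_neg u)
  simpa using! this

lemma v_add_coe (z u : ℂ) : v τ ν z (u + τ) = exp (-(4 * Real.pi * I * z)) * v τ ν z u := by
  simp only [v_eq_sum, vTerm_add_coe, Finset.mul_sum]
  exact Finset.sum_congr rfl fun a _ => by ring

/-- The identity behind the trace of the Lax matrix. -/
lemma v_symm_add_weierstrassP {z : ℂ} (hz : 2 * z ∉ (periods τ).lattice) (ν νbar : Fin 4 → ℂ) :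
    ∃ C, ∀ u ∈ regularSet τ ν νbar,
      v τ ν z u * v τ νbar z (-u) + v τ ν z (-u) * v τ νbar z u
        + 2 * ∑ a, ν a * νbar a * (periods τ).weierstrassP (u + halfPeriod τ a) = C := by
  choose C hC using vTerm_symm_eq_const hz
  refine ⟨∑ a, ∑ b, ν a * νbar b * C a b, fun u hu => ?_⟩
  have h : ∀ a b, ν a * νbar b * C a b = ν a * νbar b * (vTerm τ z a u * vTerm τ z b (-u)
      + vTerm τ z a (-u) * vTerm τ z b u
      + (if a = b then 2 * (periods τ).weierstrassP (u + halfPeriod τ a) else 0)) := by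
    intro a b
    -- The regular set avoids only the poles of terms with a nonzero coefficient; the remaining
    -- products carry the factor 0.
    by_cases ha : ν a = 0
    · simp [ha]
    by_cases hb : νbar b = 0
    · simp [hb]
    rw [hC a b u (hu a (Or.inl ha)) (hu b (Or.inr hb))]
  simp only [v_eq_sum, Finset.sum_mul_sum]
  simp only [h, mul_add, Finset.sum_add_distrib, mul_ite, mul_zero, Finset.sum_ite_eq,
    Finset.mem_univ, if_true, Finset.mul_sum]
  congr 1
  · congr 1 <;> exact Finset.sum_congr rfl fun a _ => Finset.sum_congr rfl fun b _ => by ring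
  · exact Finset.sum_congr rfl fun a _ => by ring

end

/-! ### Differentiated identities -/

lemma hasDerivAt_weierstrassP {τ : UpperHalfPlane} {u : ℂ} (hu : u ∉ (periods τ).lattice) :
    HasDerivAt (periods τ).weierstrassP ((periods τ).derivWeierstrassP u) u := by
  have h := ((periods τ).analyticOnNhd_weierstrassP u hu).differentiableAt.hasDerivAt
  rwa [(periods τ).deriv_weierstrassP] at h

lemma hasDerivAt_sum_weierstrassP {τ : UpperHalfPlane} {ν νbar : Fin 4 → ℂ} {q : ℂ}
    (hq : q ∈ regularSet τ ν νbar) :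
    HasDerivAt (fun u => ∑ a, ν a * νbar a * (periods τ).weierstrassP (u + halfPeriod τ a))
      (∑ a, ν a * νbar a * (periods τ).derivWeierstrassP (q + halfPeriod τ a)) q := by
  refine HasDerivAt.fun_sum fun a _ => ?_
  by_cases ha : ν a = 0
  · simpa [ha] using hasDerivAt_const q (0 : ℂ)
  · exact ((hasDerivAt_weierstrassP (hq a (Or.inl ha))).comp_add_const q
      (halfPeriod τ a)).const_mul (ν a * νbar a)

/-- The derivative of the identity behind the trace of the Lax matrix. -/
lemma v_symm_deriv {τ : UpperHalfPlane} {ν νbar : Fin 4 → ℂ} {z q : ℂ}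
    (hz : 2 * z ∉ (periods τ).lattice) (hq : q ∈ regularSet τ ν νbar) :
    v' τ ν z q * v τ νbar z (-q) - v τ ν z q * v' τ νbar z (-q)
      - v' τ ν z (-q) * v τ νbar z q + v τ ν z (-q) * v' τ νbar z q
      = -(2 * ∑ a, ν a * νbar a * (periods τ).derivWeierstrassP (q + halfPeriod τ a)) := by
  obtain ⟨C, hC⟩ := v_symm_add_weierstrassP hz ν νbar
  have hq' : q ∈ regularSet τ νbar ν := regularSet_swap ▸ hq
  have h1 := (((hasDerivAt_v z hq).mul (hasDerivAt_v_neg z hq')).add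
    ((hasDerivAt_v_neg z hq).mul (hasDerivAt_v z hq'))).add
    ((hasDerivAt_sum_weierstrassP hq).const_mul 2)
  have h2 : HasDerivAt (fun _ : ℂ => C) 0 q := hasDerivAt_const q C
  have h3 := h1.unique (h2.congr_of_eventuallyEq (by
    filter_upwards [isOpen_regularSet.mem_nhds hq] with u hu
    exact hC u hu))
  linear_combination h3

/-- The Wronskian-type expression entering the determinant of `L(z)` does not depend on `z`. -/
lemma v_antisymm_deriv {τ : UpperHalfPlane} {ν : Fin 4 → ℂ} {z η q : ℂ}
    (hz : 2 * z ∉ (periods τ).lattice) (hη : 2 * η ∉ (periods τ).lattice)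
    (hq : q ∈ regularSet τ ν ν) :
    v' τ ν z q * v τ ν z (-q) - v τ ν z q * v' τ ν z (-q)
      = v' τ ν η q * v τ ν η (-q) - v τ ν η q * v' τ ν η (-q) := by
  -- For ν̄ = ν the left-hand side of `v_symm_deriv` is twice the expression in question, and the
  -- right-hand side is free of the spectral parameter.
  have h1 := v_symm_deriv hz hq
  have h2 := v_symm_deriv hη hq
  linear_combination (h1 - h2) / 2

/-! ### Derivatives of the Lax matrix and the commutator identity -/

namespace Model

variable {m : Model}

lemma regular_left {q : ℂ} (hq : q ∈ regularSet m.τ m.ν m.νbar) :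
    q ∈ regularSet m.τ m.ν m.ν := regularSet_subset_self hq

lemma regular_right {q : ℂ} (hq : q ∈ regularSet m.τ m.ν m.νbar) :
    q ∈ regularSet m.τ m.νbar m.νbar := regularSet_subset_self (regularSet_swap ▸ hq)

lemma exp_div_eq (c p : ℂ) : exp (p / c) = exp (p / (2 * c)) * exp (p / (2 * c)) := by
  rw [← Complex.exp_add]
  congr 1
  ring

lemma exp_mul_exp_neg_div (c p : ℂ) : exp (p / c) * exp (-p / c) = 1 := by
  rw [← Complex.exp_add, neg_div]
  simp

/-- The partial derivative of the Lax matrix with respect to `q`. -/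
def laxDq (m : Model) (z q p : ℂ) : Matrix (Fin 2) (Fin 2) ℂ :=
  !![(v' m.τ m.ν m.η q * v m.τ m.νbar m.ηbar q + v m.τ m.ν m.η q * v' m.τ m.νbar m.ηbar q)
        * exp (p / (2 * m.c)) ^ 2
        + (v' m.τ m.ν z q * v m.τ m.νbar z (-q) - v m.τ m.ν z q * v' m.τ m.νbar z (-q)),
      (v' m.τ m.ν m.η q * v m.τ m.νbar z q + v m.τ m.ν m.η q * v' m.τ m.νbar z q)
        * exp (p / (2 * m.c))
        + (v' m.τ m.ν z q * v m.τ m.νbar m.ηbar (-q) - v m.τ m.ν z q * v' m.τ m.νbar m.ηbar (-q))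
        * exp (-p / (2 * m.c));
      (v m.τ m.ν z (-q) * v' m.τ m.νbar m.ηbar q - v' m.τ m.ν z (-q) * v m.τ m.νbar m.ηbar q)
        * exp (p / (2 * m.c))
        - (v' m.τ m.ν m.η (-q) * v m.τ m.νbar z (-q) + v m.τ m.ν m.η (-q) * v' m.τ m.νbar z (-q))
        * exp (-p / (2 * m.c)),
      v m.τ m.ν z (-q) * v' m.τ m.νbar z q - v' m.τ m.ν z (-q) * v m.τ m.νbar z q
        - (v' m.τ m.ν m.η (-q) * v m.τ m.νbar m.ηbar (-q)
          + v m.τ m.ν m.η (-q) * v' m.τ m.νbar m.ηbar (-q)) * exp (-p / (2 * m.c)) ^ 2]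

/-- The partial derivative of the Lax matrix with respect to `p`. -/
def laxDp (m : Model) (z q p : ℂ) : Matrix (Fin 2) (Fin 2) ℂ :=
  !![1 / m.c * (v m.τ m.ν m.η q * v m.τ m.νbar m.ηbar q * exp (p / (2 * m.c)) ^ 2),
      1 / (2 * m.c) * (v m.τ m.ν m.η q * v m.τ m.νbar z q * exp (p / (2 * m.c))
        - v m.τ m.ν z q * v m.τ m.νbar m.ηbar (-q) * exp (-p / (2 * m.c)));
      1 / (2 * m.c) * (v m.τ m.ν z (-q) * v m.τ m.νbar m.ηbar q * exp (p / (2 * m.c))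
        - v m.τ m.ν m.η (-q) * v m.τ m.νbar z (-q) * exp (-p / (2 * m.c))),
      -(1 / m.c * (v m.τ m.ν m.η (-q) * v m.τ m.νbar m.ηbar (-q) * exp (-p / (2 * m.c)) ^ 2))]

/-- The chain rule for the Lax matrix along a differentiable curve. -/
lemma hasDerivAt_lax {𝕜 : Type*} [NontriviallyNormedField 𝕜] [NormedAlgebra 𝕜 ℂ] (z : ℂ)
    {q p : 𝕜 → ℂ} {t : 𝕜} {a b : ℂ} (hU : q t ∈ regularSet m.τ m.ν m.νbar)
    (hq : HasDerivAt q a t) (hp : HasDerivAt p b t) (i j : Fin 2) :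
    HasDerivAt (fun s => m.lax z (q s) (p s) i j)
      (a * m.laxDq z (q t) (p t) i j + b * m.laxDp z (q t) (p t) i j) t := by
  have hν := regular_left hU
  have hνb := regular_right hU
  have E : HasDerivAt (fun s => exp (p s / (2 * m.c)))
      (exp (p t / (2 * m.c)) * (b / (2 * m.c))) t := (hp.div_const (2 * m.c)).cexp
  have F : HasDerivAt (fun s => exp (-p s / (2 * m.c)))
      (exp (-p t / (2 * m.c)) * (-b / (2 * m.c))) t := (hp.neg.div_const (2 * m.c)).cexp
  have f : ∀ z, HasDerivAt (fun s => v m.τ m.ν z (q s)) (v' m.τ m.ν z (q t) * a) t :=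
    fun z => (hasDerivAt_v z hν).comp t hq
  have fm : ∀ z, HasDerivAt (fun s => v m.τ m.ν z (-q s)) (-v' m.τ m.ν z (-q t) * a) t :=
    fun z => (hasDerivAt_v_neg z hν).comp t hq
  have fb : ∀ z, HasDerivAt (fun s => v m.τ m.νbar z (q s)) (v' m.τ m.νbar z (q t) * a) t :=
    fun z => (hasDerivAt_v z hνb).comp t hq
  have fbm : ∀ z, HasDerivAt (fun s => v m.τ m.νbar z (-q s)) (-v' m.τ m.νbar z (-q t) * a) t :=
    fun z => (hasDerivAt_v_neg z hνb).comp t hq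
  fin_cases i <;> fin_cases j <;>
    simp only [lax, L, Lbar, Matrix.mul_apply, Fin.sum_univ_two, laxDq, laxDp, Fin.zero_eta,
      Fin.mk_one, Matrix.of_apply, Matrix.cons_val', Matrix.cons_val_zero, Matrix.cons_val_one,
      Matrix.cons_val_fin_one]
  · exact ((((f m.η).fun_mul E).fun_mul ((fb m.ηbar).fun_mul E)).add ((f z).fun_mul (fbm z)))
      |>.congr_deriv (by ring)
  · exact ((((f m.η).fun_mul E).fun_mul (fb z)).add ((f z).fun_mul ((fbm m.ηbar).fun_mul F)))
      |>.congr_deriv (by ring)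
  · exact (((fm z).fun_mul ((fb m.ηbar).fun_mul E)).add (((fm m.η).fun_mul F).fun_mul (fbm z)))
      |>.congr_deriv (by ring)
  · exact (((fm z).fun_mul (fb z)).add (((fm m.η).fun_mul F).fun_mul ((fbm m.ηbar).fun_mul F)))
      |>.congr_deriv (by ring)

lemma laxVariation_eq (z : ℂ) {q : ℂ} (hq : q ∈ regularSet m.τ m.ν m.νbar) (p a b : ℂ) :
    m.laxVariation z q p a b = a • m.laxDq z q p + b • m.laxDp z q p := by
  ext i j
  -- The partial derivatives are the chain rule over ℂ along the two coordinate lines; curves in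
  -- real time use it over ℝ.
  have h1 := (hasDerivAt_lax (𝕜 := ℂ) z (q := fun x => x) (p := fun _ => p) hq (hasDerivAt_id q)
    (hasDerivAt_const q p) i j).deriv
  have h2 := (hasDerivAt_lax (𝕜 := ℂ) z (q := fun _ => q) (p := fun y => y) (t := p) hq
    (hasDerivAt_const p q) (hasDerivAt_id p) i j).deriv
  simp only [laxVariation, Matrix.of_apply, h1, h2, Matrix.add_apply, Matrix.smul_apply,
    smul_eq_mul]
  ring

lemma hasDerivAt_hamiltonian_right (q p : ℂ) :
    HasDerivAt (fun y => m.hamiltonian q y)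
      (1 / m.c * (v m.τ m.ν m.η q * v m.τ m.νbar m.ηbar q * exp (p / m.c)
        - v m.τ m.ν m.η (-q) * v m.τ m.νbar m.ηbar (-q) * exp (-p / m.c))) p := by
  have E : HasDerivAt (fun y : ℂ => exp (y / m.c)) (exp (p / m.c) * (1 / m.c)) p :=
    ((hasDerivAt_id p).div_const m.c).cexp
  have F : HasDerivAt (fun y : ℂ => exp (-y / m.c)) (exp (-p / m.c) * (-1 / m.c)) p :=
    ((hasDerivAt_id p).neg.div_const m.c).cexp
  exact (((E.const_mul _).add (F.const_mul _)).sub_const _).congr_deriv (by ring)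

lemma hasDerivAt_mul_v {q : ℂ} (hq : q ∈ regularSet m.τ m.ν m.νbar) :
    HasDerivAt (fun u => v m.τ m.ν m.η u * v m.τ m.νbar m.ηbar u)
      (v' m.τ m.ν m.η q * v m.τ m.νbar m.ηbar q + v m.τ m.ν m.η q * v' m.τ m.νbar m.ηbar q) q :=
  (hasDerivAt_v m.η (regular_left hq)).mul (hasDerivAt_v m.ηbar (regular_right hq))

lemma hasDerivAt_hamiltonian_left {q : ℂ} (hq : q ∈ regularSet m.τ m.ν m.νbar) (p : ℂ) :
    HasDerivAt (fun x => m.hamiltonian x p)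
      (deriv (fun u => v m.τ m.ν m.η u * v m.τ m.νbar m.ηbar u) q * exp (p / m.c)
        - deriv (fun u => v m.τ m.ν m.η u * v m.τ m.νbar m.ηbar u) (-q) * exp (-p / m.c)
        - 2 * ∑ a, m.ν a * m.νbar a *
            (periods m.τ).derivWeierstrassP (q + halfPeriod m.τ a)) q := by
  have h1 := hasDerivAt_mul_v hq
  have h2 := hasDerivAt_mul_v (neg_mem_regularSet.2 hq)
  have h3 := h2.comp q (hasDerivAt_neg q)
  rw [h1.deriv, h2.deriv]
  exact (((h1.mul_const _).add (h3.mul_const _)).sub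
    ((hasDerivAt_sum_weierstrassP hq).const_mul 2)).congr_deriv (by ring)

/-- The trace of the Lax matrix is the Hamiltonian, up to a function of `z`. -/
lemma laxDp_trace (z q p : ℂ) :
    m.laxDp z q p 0 0 + m.laxDp z q p 1 1 = m.dpH q p := by
  rw [dpH, (hasDerivAt_hamiltonian_right q p).deriv, exp_div_eq, exp_div_eq m.c (-p)]
  simp [laxDp]
  ring

/-- The exponential terms of tr ℒ are those of H; the remaining, z-dependent terms have the same
q-derivative as −2 ∑ νₐ ν̄ₐ ℘(q + ωₐ) by `v_symm_deriv`. -/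
lemma laxDq_trace {z : ℂ} (hz : z ∈ m.spectralDomain) {q : ℂ}
    (hq : q ∈ regularSet m.τ m.ν m.νbar) (p : ℂ) :
    m.laxDq z q p 0 0 + m.laxDq z q p 1 1 = m.dqH q p := by
  rw [dqH, (hasDerivAt_hamiltonian_left hq p).deriv, (hasDerivAt_mul_v hq).deriv,
    (hasDerivAt_mul_v (neg_mem_regularSet.2 hq)).deriv, exp_div_eq, exp_div_eq m.c (-p)]
  have := v_symm_deriv hz hq
  simp [laxDq]
  linear_combination this

/-- The commutator is the derivative of the Lax matrix along the Hamiltonian vector field. -/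
lemma laxCommutator_eq (hη : 2 * m.η ∉ m.lattice) (hηbar : 2 * m.ηbar ∉ m.lattice) {z : ℂ}
    (hz : z ∈ m.spectralDomain) {q : ℂ} (hq : q ∈ regularSet m.τ m.ν m.νbar) (p : ℂ) :
    m.laxCommutator z q p = m.dpH q p • m.laxDq z q p - m.dqH q p • m.laxDp z q p := by
  have R := v_antisymm_deriv hz hη (regular_left hq)
  have Rb := v_antisymm_deriv hz hηbar (regular_right hq)
  have hEF := exp_mul_exp_neg_div (2 * m.c) p
  -- Replacing H_p and H_q by traces eliminates ℘'. What remains is an algebraic identity in the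
  -- values of v, v' and the exponentials, modulo the relations `hEF`, `R` and `Rb`.
  have hHp := laxDp_trace (m := m) z q p
  have hHq := laxDq_trace hz hq p
  simp only [laxDq, laxDp, Matrix.of_apply, Matrix.cons_val', Matrix.cons_val_zero,
    Matrix.cons_val_one, Matrix.cons_val_fin_one] at hHp hHq
  rw [laxCommutator, M, ← hHp, ← hHq, exp_div_eq, exp_div_eq m.c (-p), lax, L, Lbar, laxDq, laxDp]
  generalize v' m.τ m.ν z q = f' at *
  generalize v' m.τ m.ν z (-q) = fm' at *
  generalize v' m.τ m.νbar z q = fb' at *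
  generalize v' m.τ m.νbar z (-q) = fbm' at *
  generalize v' m.τ m.ν m.η q = g' at *
  generalize v' m.τ m.ν m.η (-q) = gm' at *
  generalize v' m.τ m.νbar m.ηbar q = gb' at *
  generalize v' m.τ m.νbar m.ηbar (-q) = gbm' at *
  generalize v m.τ m.ν z q = f at *
  generalize v m.τ m.ν z (-q) = fm at *
  generalize v m.τ m.νbar z q = fb at *
  generalize v m.τ m.νbar z (-q) = fbm at *
  generalize v m.τ m.ν m.η q = g at *
  generalize v m.τ m.ν m.η (-q) = gm at *
  generalize v m.τ m.νbar m.ηbar q = gb at *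
  generalize v m.τ m.νbar m.ηbar (-q) = gbm at *
  generalize exp (p / (2 * m.c)) = E at *
  generalize exp (-p / (2 * m.c)) = F at *
  clear hHp hHq
  ext i j
  fin_cases i <;> fin_cases j <;>
    simp only [Matrix.mul_apply, Fin.sum_univ_two, Fin.zero_eta, Matrix.sub_apply,
      Matrix.smul_apply, smul_eq_mul,
      Fin.mk_one, Matrix.of_apply, Matrix.cons_val', Matrix.cons_val_zero, Matrix.cons_val_one,
      Matrix.cons_val_fin_one]
  · linear_combination (-1 / m.c) * ((g * gb * (gm' * gbm + gm * gbm')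
      - gm * gbm * (g' * gb + g * gb')) * E * F * hEF + gb * gbm * E * F * R + g * gm * E * F * Rb)
  · linear_combination (-1 / m.c) * ((E * f * g * (gb' * gbm - gb * gbm')
      + F * gbm * fb * (gm' * g - gm * g')) * hEF - f * g * E * Rb + gbm * fb * F * R)
  · linear_combination (-1 / m.c) * ((F * fm * gm * (gbm' * gb - gbm * gb')
      + E * gb * fbm * (g' * gm - g * gm')) * hEF + fm * gm * F * Rb - gb * fbm * E * R)
  · linear_combination (1 / m.c) * ((g * gb * (gm' * gbm + gm * gbm')
      - gm * gbm * (g' * gb + g * gb')) * E * F * hEF + gb * gbm * E * F * R + g * gm * E * F * Rb)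

end Model

/-! ### Nonvanishing of v and of its Wronskians -/

section

variable {τ : UpperHalfPlane} {ν νbar : Fin 4 → ℂ}

lemma eventually_regular_of_halfPeriod (a : Fin 4) :
    ∀ᶠ u in 𝓝[≠] (-halfPeriod τ a), u ∈ regularSet τ ν νbar := by
  have h : ∀ b, ∀ᶠ u in 𝓝[≠] (-halfPeriod τ a), u + halfPeriod τ b ∉ (periods τ).lattice := by
    intro b
    have hcont : ContinuousAt (fun u => u + halfPeriod τ b) (-halfPeriod τ a) := by fun_prop
    rcases eq_or_ne b a with rfl | hab
    · have h1 := (periods τ).compl_lattice_sdiff_singleton_mem_nhds 0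
      have h2 := hcont.tendsto
      rw [neg_add_cancel] at h2
      filter_upwards [(h2.mono_left nhdsWithin_le_nhds).eventually h1, self_mem_nhdsWithin]
        with u hu hne hmem
      exact hu ⟨hmem, fun h0 => hne (eq_neg_of_add_eq_zero_left h0)⟩
    · have h1 : -halfPeriod τ a + halfPeriod τ b ∉ (periods τ).lattice := by
        rw [neg_add_eq_sub]
        exact sub_halfPeriod_notMem hab
      exact (hcont.tendsto.mono_left nhdsWithin_le_nhds).eventually
        ((periods τ).isClosed_lattice.isOpen_compl.mem_nhds h1)
  filter_upwards [eventually_all.2 h] with u hu b _ using hu b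

/-- A nonzero coupling vector gives a function `v(z, ·)` that does not vanish identically. -/
lemma exists_v_ne_zero (hν : ν ≠ 0) (νbar : Fin 4 → ℂ) {z : ℂ}
    (hz : 2 * z ∉ (periods τ).lattice) : ∃ u ∈ regularSet τ ν νbar, v τ ν z u ≠ 0 := by
  obtain ⟨a, ha⟩ := Function.ne_iff.1 hν
  by_contra! h
  obtain ⟨k, hk, hk0, hk'⟩ := exists_kronecker_eq_div hz
  set e := exp (4 * Real.pi * I * z * halfPeriodDeriv a) with he
  have hadd : Tendsto (fun u => u + halfPeriod τ a) (𝓝 (-halfPeriod τ a)) (𝓝 0) := by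
    have : ContinuousAt (fun u => u + halfPeriod τ a) (-halfPeriod τ a) := by fun_prop
    simpa [ContinuousAt] using this
  -- The residue of v at −ωₐ is νₐ e: only the a-th term has a pole there. It would be 0 if v
  -- vanished identically.
  have hterm : ∀ b, Tendsto (fun u => (u + halfPeriod τ a) * (ν b * vTerm τ z b u))
      (𝓝[≠] (-halfPeriod τ a)) (𝓝 (if b = a then ν a * e else 0)) := by
    intro b
    split_ifs with hab
    · subst hab
      have h1 : Tendsto (fun u => ν b * (e * k (u + halfPeriod τ b))) (𝓝[≠] (-halfPeriod τ b))
          (𝓝 (ν b * (e * 1))) :=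
        (((hk0 ▸ hk.continuousAt.tendsto).comp hadd).const_mul e |>.const_mul (ν b)).mono_left
          nhdsWithin_le_nhds
      rw [mul_one] at h1
      refine h1.congr' ?_
      filter_upwards [self_mem_nhdsWithin] with u hu
      have hy : u + halfPeriod τ b ≠ 0 := fun h0 => hu (eq_neg_of_add_eq_zero_left h0)
      rw [vTerm, hk', ← he]
      field_simp
    · have h1 : -halfPeriod τ a + halfPeriod τ b ∉ (periods τ).lattice := by
        rw [neg_add_eq_sub]
        exact sub_halfPeriod_notMem hab
      have h2 := (analyticAt_vTerm z h1).continuousAt.tendsto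
      have h3 := (hadd.mul (h2.const_mul (ν b))).mono_left
        (nhdsWithin_le_nhds (s := {-halfPeriod τ a}ᶜ))
      rwa [zero_mul] at h3
  have hsum := tendsto_finsetSum Finset.univ fun b _ => hterm b
  rw [Finset.sum_ite_eq' Finset.univ a, if_pos (Finset.mem_univ a)] at hsum
  have hzero : Tendsto (fun u => ∑ b, (u + halfPeriod τ a) * (ν b * vTerm τ z b u))
      (𝓝[≠] (-halfPeriod τ a)) (𝓝 0) := by
    refine tendsto_const_nhds.congr' ?_
    filter_upwards [eventually_regular_of_halfPeriod (ν := ν) (νbar := νbar) a] with u hu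
    rw [← Finset.mul_sum, ← v_eq_sum, h u hu, mul_zero]
  exact mul_ne_zero ha (Complex.exp_ne_zero _) (tendsto_nhds_unique hsum hzero)

lemma analyticOnNhd_v (z : ℂ) : AnalyticOnNhd ℂ (fun u => v τ ν z u) (regularSet τ ν νbar) :=
  fun _ hu => analyticAt_v z hu

lemma analyticOnNhd_v' (z : ℂ) : AnalyticOnNhd ℂ (fun u => v' τ ν z u) (regularSet τ ν νbar) :=
  (analyticOnNhd_v z).deriv

/-- The functions `v(z₁, ·)` and `v(z₂, ·)` are linearly independent if their multipliers differ. -/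
lemma exists_wronskian_v_ne_zero (hν : ν ≠ 0) (νbar : Fin 4 → ℂ) {z₁ z₂ : ℂ}
    (hz₁ : 2 * z₁ ∉ (periods τ).lattice) (hz₂ : 2 * z₂ ∉ (periods τ).lattice)
    (hexp : exp (-(4 * Real.pi * I * z₁)) ≠ exp (-(4 * Real.pi * I * z₂))) :
    ∃ u ∈ regularSet τ ν νbar, v' τ ν z₁ u * v τ ν z₂ u - v' τ ν z₂ u * v τ ν z₁ u ≠ 0 := by
  by_contra! h
  obtain ⟨u₀, hu₀, hne⟩ := exists_v_ne_zero hν νbar hz₂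
  have ha₁ := analyticOnNhd_v (τ := τ) (ν := ν) (νbar := νbar) z₁
  have ha₂ := analyticOnNhd_v (τ := τ) (ν := ν) (νbar := νbar) z₂
  obtain ⟨r, hr, hball⟩ := Metric.eventually_nhds_iff_ball.1
    ((isOpen_regularSet.eventually_mem hu₀).and ((ha₂ u₀ hu₀).continuousAt.eventually_ne hne))
  -- A vanishing Wronskian makes the quotient locally constant where the denominator is nonzero; the
  -- identity theorem then makes the two functions proportional on the whole regular set.
  have hquot : ∀ u ∈ Metric.ball u₀ r, HasDerivAt (fun u => v τ ν z₁ u / v τ ν z₂ u) 0 u := by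
    intro u hu
    obtain ⟨hU, h0⟩ := hball u hu
    refine ((hasDerivAt_v z₁ hU).fun_div (hasDerivAt_v z₂ hU) h0).congr_deriv ?_
    rw [div_eq_zero_iff]
    left
    linear_combination h u hU
  obtain ⟨C, hC⟩ := Metric.isOpen_ball.exists_is_const_of_deriv_eq_zero
    (convex_ball u₀ r).isPreconnected
    (fun u hu => (hquot u hu).differentiableAt.differentiableWithinAt)
    (fun u hu => (hquot u hu).deriv)
  have heq : Set.EqOn (fun u => v τ ν z₁ u) (fun u => C * v τ ν z₂ u) (regularSet τ ν νbar) := by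
    refine ha₁.eqOn_of_preconnected_of_eventuallyEq (fun u hu => analyticAt_const.mul (ha₂ u hu))
      isPreconnected_regularSet hu₀ ?_
    filter_upwards [Metric.ball_mem_nhds u₀ hr] with u hu
    exact (div_eq_iff (hball u hu).2).1 (hC u hu)
  obtain ⟨u₁, hu₁, hne₁⟩ := exists_v_ne_zero hν νbar hz₁
  have h1 : v τ ν z₁ u₁ = C * v τ ν z₂ u₁ := heq hu₁
  -- Proportional functions have equal multipliers under u ↦ u + τ, which contradicts `hexp`.
  have h2 : v τ ν z₁ (u₁ + τ) = C * v τ ν z₂ (u₁ + τ) := heq (add_coe_mem_regularSet.2 hu₁)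
  rw [v_add_coe, v_add_coe] at h2
  have h3 : (exp (-(4 * Real.pi * I * z₁)) - exp (-(4 * Real.pi * I * z₂))) * v τ ν z₁ u₁ = 0 := by
    linear_combination h2 - exp (-(4 * Real.pi * I * z₂)) * h1
  exact (mul_ne_zero (sub_ne_zero.2 hexp) hne₁) h3

/-- An analytic function on a connected open set that does not vanish identically is nonzero on a
dense subset. -/
lemma mem_closure_ne_zero {f : ℂ → ℂ} {U : Set ℂ} (hf : AnalyticOnNhd ℂ f U)
    (hU : IsPreconnected U) (hUo : IsOpen U) (hne : ∃ u ∈ U, f u ≠ 0) {u₀ : ℂ} (hu₀ : u₀ ∈ U) :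
    u₀ ∈ closure {u ∈ U | f u ≠ 0} := by
  by_contra h
  obtain ⟨u, hu, hfu⟩ := hne
  refine hfu (hf.eqOn_zero_of_preconnected_of_eventuallyEq_zero hU hu₀ ?_ hu)
  filter_upwards [isClosed_closure.isOpen_compl.mem_nhds h, hUo.mem_nhds hu₀] with w hw hwU
  by_contra hfw
  exact hw (subset_closure ⟨hwU, hfw⟩)

end

/-! ### Nondegenerate points: openness and density -/

namespace Model

variable {m : Model}

/-- The determinant of two entries of the derivatives of the Lax matrix. -/
def minor (m : Model) (k l : m.spectralDomain × Fin 2 × Fin 2) (x : ℂ × ℂ) : ℂ :=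
  m.laxDq k.1 x.1 x.2 k.2.1 k.2.2 * m.laxDp l.1 x.1 x.2 l.2.1 l.2.2
    - m.laxDq l.1 x.1 x.2 l.2.1 l.2.2 * m.laxDp k.1 x.1 x.2 k.2.1 k.2.2

lemma mem_nondegenerateSet_iff {x : ℂ × ℂ} :
    x ∈ m.nondegenerateSet ↔ x ∈ m.phaseSpace ∧ ∃ k l, m.minor k l x ≠ 0 := by
  rw [nondegenerateSet, Set.mem_sep_iff]
  refine and_congr_right fun hx => ?_
  have hq : x.1 ∈ regularSet m.τ m.ν m.νbar := hx
  have hvar : ∀ a b : ℂ, (∀ z ∈ m.spectralDomain, m.laxVariation z x.1 x.2 a b = 0) ↔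
      ∀ k : m.spectralDomain × Fin 2 × Fin 2, a * m.laxDq k.1 x.1 x.2 k.2.1 k.2.2
        + b * m.laxDp k.1 x.1 x.2 k.2.1 k.2.2 = 0 := by
    intro a b
    constructor
    · rintro h ⟨⟨z, hz⟩, i, j⟩
      have := congrFun (congrFun (h z hz) i) j
      rw [laxVariation_eq z hq] at this
      simpa using this
    · intro h z hz
      rw [laxVariation_eq z hq]
      ext i j
      simpa using h ⟨⟨z, hz⟩, i, j⟩
  simp only [hvar]
  constructor
  · intro h
    by_contra! hm
    have h1 : ∀ k : m.spectralDomain × Fin 2 × Fin 2, m.laxDq k.1 x.1 x.2 k.2.1 k.2.2 = 0 ∧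
        m.laxDp k.1 x.1 x.2 k.2.1 k.2.2 = 0 := by
      intro k
      -- If all minors vanish, the direction (ℒ_p entry, −ℒ_q entry) built from any one entry
      -- annihilates every entry, so it is zero. All entries then vanish, and (1, 0) is a forbidden
      -- direction.
      have := h (m.laxDp k.1 x.1 x.2 k.2.1 k.2.2) (-m.laxDq k.1 x.1 x.2 k.2.1 k.2.2) fun l => by
        have := hm l k
        rw [minor] at this
        linear_combination this
      exact ⟨neg_eq_zero.1 this.2, this.1⟩
    exact one_ne_zero (h 1 0 fun k => by simp [(h1 k).1]).1
  · rintro ⟨k, l, hkl⟩ a b hab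
    have hk := hab k
    have hl := hab l
    rw [minor] at hkl
    constructor
    · refine (mul_eq_zero.1 ?_).resolve_right hkl
      linear_combination m.laxDp l.1 x.1 x.2 l.2.1 l.2.2 * hk
        - m.laxDp k.1 x.1 x.2 k.2.1 k.2.2 * hl
    · refine (mul_eq_zero.1 ?_).resolve_right hkl
      linear_combination m.laxDq k.1 x.1 x.2 k.2.1 k.2.2 * hl
        - m.laxDq l.1 x.1 x.2 l.2.1 l.2.2 * hk

lemma isOpen_phaseSpace : IsOpen m.phaseSpace :=
  isOpen_regularSet.preimage (f := fun x : ℂ × ℂ => x.1) continuous_fst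

lemma continuousOn_comp_fst {f : ℂ → ℂ} (hf : AnalyticOnNhd ℂ f (regularSet m.τ m.ν m.νbar)) :
    ContinuousOn (fun x : ℂ × ℂ => f x.1) m.phaseSpace :=
  hf.continuousOn.comp continuousOn_fst fun _ hx => hx

lemma continuousOn_comp_neg_fst {f : ℂ → ℂ}
    (hf : AnalyticOnNhd ℂ f (regularSet m.τ m.ν m.νbar)) :
    ContinuousOn (fun x : ℂ × ℂ => f (-x.1)) m.phaseSpace :=
  hf.continuousOn.comp continuousOn_fst.neg fun _ hx => neg_mem_regularSet.2 hx

lemma analyticOnNhd_v_left (z : ℂ) :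
    AnalyticOnNhd ℂ (fun u => v m.τ m.ν z u) (regularSet m.τ m.ν m.νbar) :=
  analyticOnNhd_v z

lemma analyticOnNhd_v_right (z : ℂ) :
    AnalyticOnNhd ℂ (fun u => v m.τ m.νbar z u) (regularSet m.τ m.ν m.νbar) :=
  regularSet_swap (τ := m.τ) ▸ analyticOnNhd_v z

lemma analyticOnNhd_v'_left (z : ℂ) :
    AnalyticOnNhd ℂ (fun u => v' m.τ m.ν z u) (regularSet m.τ m.ν m.νbar) :=
  analyticOnNhd_v' z

lemma analyticOnNhd_v'_right (z : ℂ) :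
    AnalyticOnNhd ℂ (fun u => v' m.τ m.νbar z u) (regularSet m.τ m.ν m.νbar) :=
  regularSet_swap (τ := m.τ) ▸ analyticOnNhd_v' z

lemma continuousOn_laxDq (z : ℂ) (i j : Fin 2) :
    ContinuousOn (fun x : ℂ × ℂ => m.laxDq z x.1 x.2 i j) m.phaseSpace := by
  have h1 : ∀ z, ContinuousOn (fun x : ℂ × ℂ => v m.τ m.ν z x.1) m.phaseSpace := fun z =>
    continuousOn_comp_fst (analyticOnNhd_v_left z)
  have h2 : ∀ z, ContinuousOn (fun x : ℂ × ℂ => v m.τ m.νbar z x.1) m.phaseSpace := fun z =>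
    continuousOn_comp_fst (analyticOnNhd_v_right z)
  have h3 : ∀ z, ContinuousOn (fun x : ℂ × ℂ => v' m.τ m.ν z x.1) m.phaseSpace := fun z =>
    continuousOn_comp_fst (analyticOnNhd_v'_left z)
  have h4 : ∀ z, ContinuousOn (fun x : ℂ × ℂ => v' m.τ m.νbar z x.1) m.phaseSpace := fun z =>
    continuousOn_comp_fst (analyticOnNhd_v'_right z)
  have h5 : ∀ z, ContinuousOn (fun x : ℂ × ℂ => v m.τ m.ν z (-x.1)) m.phaseSpace := fun z =>
    continuousOn_comp_neg_fst (analyticOnNhd_v_left z)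
  have h6 : ∀ z, ContinuousOn (fun x : ℂ × ℂ => v m.τ m.νbar z (-x.1)) m.phaseSpace := fun z =>
    continuousOn_comp_neg_fst (analyticOnNhd_v_right z)
  have h7 : ∀ z, ContinuousOn (fun x : ℂ × ℂ => v' m.τ m.ν z (-x.1)) m.phaseSpace := fun z =>
    continuousOn_comp_neg_fst (analyticOnNhd_v'_left z)
  have h8 : ∀ z, ContinuousOn (fun x : ℂ × ℂ => v' m.τ m.νbar z (-x.1)) m.phaseSpace := fun z =>
    continuousOn_comp_neg_fst (analyticOnNhd_v'_right z)
  have E : ContinuousOn (fun x : ℂ × ℂ => exp (x.2 / (2 * m.c))) m.phaseSpace :=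
    (continuous_snd.div_const _).cexp.continuousOn
  have F : ContinuousOn (fun x : ℂ × ℂ => exp (-x.2 / (2 * m.c))) m.phaseSpace :=
    (continuous_snd.neg.div_const _).cexp.continuousOn
  fin_cases i <;> fin_cases j
  · exact ((((h3 m.η).mul (h2 m.ηbar)).add ((h1 m.η).mul (h4 m.ηbar))).mul (E.pow 2)).add
      (((h3 z).mul (h6 z)).sub ((h1 z).mul (h8 z)))
  · exact ((((h3 m.η).mul (h2 z)).add ((h1 m.η).mul (h4 z))).mul E).add
      ((((h3 z).mul (h6 m.ηbar)).sub ((h1 z).mul (h8 m.ηbar))).mul F)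
  · exact ((((h5 z).mul (h4 m.ηbar)).sub ((h7 z).mul (h2 m.ηbar))).mul E).sub
      ((((h7 m.η).mul (h6 z)).add ((h5 m.η).mul (h8 z))).mul F)
  · exact (((h5 z).mul (h4 z)).sub ((h7 z).mul (h2 z))).sub
      ((((h7 m.η).mul (h6 m.ηbar)).add ((h5 m.η).mul (h8 m.ηbar))).mul (F.pow 2))

lemma continuousOn_laxDp (z : ℂ) (i j : Fin 2) :
    ContinuousOn (fun x : ℂ × ℂ => m.laxDp z x.1 x.2 i j) m.phaseSpace := by
  have h1 : ∀ z, ContinuousOn (fun x : ℂ × ℂ => v m.τ m.ν z x.1) m.phaseSpace := fun z =>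
    continuousOn_comp_fst (analyticOnNhd_v_left z)
  have h2 : ∀ z, ContinuousOn (fun x : ℂ × ℂ => v m.τ m.νbar z x.1) m.phaseSpace := fun z =>
    continuousOn_comp_fst (analyticOnNhd_v_right z)
  have h5 : ∀ z, ContinuousOn (fun x : ℂ × ℂ => v m.τ m.ν z (-x.1)) m.phaseSpace := fun z =>
    continuousOn_comp_neg_fst (analyticOnNhd_v_left z)
  have h6 : ∀ z, ContinuousOn (fun x : ℂ × ℂ => v m.τ m.νbar z (-x.1)) m.phaseSpace := fun z =>
    continuousOn_comp_neg_fst (analyticOnNhd_v_right z)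
  have E : ContinuousOn (fun x : ℂ × ℂ => exp (x.2 / (2 * m.c))) m.phaseSpace :=
    (continuous_snd.div_const _).cexp.continuousOn
  have F : ContinuousOn (fun x : ℂ × ℂ => exp (-x.2 / (2 * m.c))) m.phaseSpace :=
    (continuous_snd.neg.div_const _).cexp.continuousOn
  fin_cases i <;> fin_cases j
  · exact continuousOn_const.mul (((h1 m.η).mul (h2 m.ηbar)).mul (E.pow 2))
  · exact continuousOn_const.mul
      ((((h1 m.η).mul (h2 z)).mul E).sub (((h1 z).mul (h6 m.ηbar)).mul F))
  · exact continuousOn_const.mul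
      ((((h5 z).mul (h2 m.ηbar)).mul E).sub (((h5 m.η).mul (h6 z)).mul F))
  · exact (continuousOn_const.mul (((h5 m.η).mul (h6 m.ηbar)).mul (F.pow 2))).neg

/-- H_q is the trace of ℒ_q at any admissible z; η serves as one. -/
lemma continuousOn_dqH (hη : 2 * m.η ∉ m.lattice) :
    ContinuousOn (fun x : ℂ × ℂ => m.dqH x.1 x.2) m.phaseSpace :=
  ((continuousOn_laxDq m.η 0 0).add (continuousOn_laxDq m.η 1 1)).congr fun x hx =>
    (laxDq_trace hη (q := x.1) hx x.2).symm

lemma continuousOn_dpH : ContinuousOn (fun x : ℂ × ℂ => m.dpH x.1 x.2) m.phaseSpace :=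
  ((continuousOn_laxDp m.η 0 0).add (continuousOn_laxDp m.η 1 1)).congr fun x _ =>
    (laxDp_trace m.η x.1 x.2).symm

lemma isOpen_nondegenerateSet : IsOpen m.nondegenerateSet := by
  have h : m.nondegenerateSet = ⋃ k, ⋃ l, m.phaseSpace ∩ m.minor k l ⁻¹' {0}ᶜ := by
    ext x
    rw [mem_nondegenerateSet_iff]
    simp
  rw [h]
  refine isOpen_iUnion fun k => isOpen_iUnion fun l => ?_
  refine ContinuousOn.isOpen_inter_preimage ?_ isOpen_phaseSpace isOpen_compl_singleton
  exact ((continuousOn_laxDq _ _ _).mul (continuousOn_laxDp _ _ _)).sub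
    ((continuousOn_laxDq _ _ _).mul (continuousOn_laxDp _ _ _))

lemma add_half_coe_mem_spectralDomain {z : ℂ} (hz : z ∈ m.spectralDomain) :
    z + m.τ / 2 ∈ m.spectralDomain := by
  intro h
  rw [show 2 * (z + (m.τ : ℂ) / 2) = 2 * z + m.τ by ring] at h
  exact hz ((add_mem_lattice_iff (coe_mem_lattice m.τ) _).1 h)

/-- The ratio of the two sides is the inverse of exp (2πiτ), whose norm is less than 1. Shifting z
by τ/2 keeps it admissible and changes the multiplier of v. -/
lemma exp_multiplier_ne (τ : UpperHalfPlane) (z : ℂ) :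
    exp (-(4 * Real.pi * I * (z + τ / 2))) ≠ exp (-(4 * Real.pi * I * z)) := by
  intro h
  have h1 : exp (-(4 * Real.pi * I * (z + τ / 2)))
      = exp (-(2 * Real.pi * I * τ)) * exp (-(4 * Real.pi * I * z)) := by
    rw [← Complex.exp_add]; congr 1; ring
  rw [h1, mul_eq_right₀ (Complex.exp_ne_zero _), Complex.exp_neg, inv_eq_one] at h
  have h2 := norm_exp_lt_one τ
  rw [h, norm_one] at h2
  exact lt_irrefl _ h2

/-- The minor of the upper right entries is quadratic in `exp (p / c)`. -/
lemma minor_mul_exp_sq (k l : m.spectralDomain) (q : ℂ) : ∃ β γ : ℂ, ∀ p : ℂ,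
    2 * (m.minor (k, 0, 1) (l, 0, 1) (q, p) * exp (p / m.c)) =
      1 / m.c * (v m.τ m.ν m.η q ^ 2 * (v' m.τ m.νbar k q * v m.τ m.νbar l q
        - v' m.τ m.νbar l q * v m.τ m.νbar k q) * exp (p / m.c) ^ 2
        + β * exp (p / m.c) + γ) := by
  let A : ℂ → ℂ := fun z =>
    v' m.τ m.ν m.η q * v m.τ m.νbar z q + v m.τ m.ν m.η q * v' m.τ m.νbar z q
  let B : ℂ → ℂ := fun z =>
    v' m.τ m.ν z q * v m.τ m.νbar m.ηbar (-q) - v m.τ m.ν z q * v' m.τ m.νbar m.ηbar (-q)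
  let C : ℂ → ℂ := fun z => v m.τ m.ν m.η q * v m.τ m.νbar z q
  let D : ℂ → ℂ := fun z => v m.τ m.ν z q * v m.τ m.νbar m.ηbar (-q)
  -- With E = e^{p/2c} and F = 1/E the entries are A E + B F and (C E − D F)/(2c). Then β and γ are
  -- the coefficients of EF and F² in the minor, and the terms containing v'(η,q) cancel from that
  -- of E².
  refine ⟨B k * C l - A k * D l - B l * C k + A l * D k, B l * D k - B k * D l, fun p => ?_⟩
  have hEF := exp_mul_exp_neg_div (2 * m.c) p
  have hEE := exp_div_eq m.c p
  simp only [minor, laxDq, laxDp, Matrix.of_apply, Matrix.cons_val', Matrix.cons_val_zero,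
    Matrix.cons_val_one, Matrix.cons_val_fin_one, hEE, A, B, C, D]
  generalize exp (p / (2 * m.c)) = E at *
  generalize exp (-p / (2 * m.c)) = F at *
  linear_combination (1 / m.c * ((B k * C l - A k * D l - B l * C k + A l * D k) * E ^ 2
    + (B l * D k - B k * D l) * (E * F + 1))) * hEF

lemma phaseSpace_subset_closure (hc : m.c ≠ 0) (hη : 2 * m.η ∉ m.lattice)
    (hηbar : 2 * m.ηbar ∉ m.lattice) (hν : m.ν ≠ 0) (hνbar : m.νbar ≠ 0) :
    m.phaseSpace ⊆ closure m.nondegenerateSet := by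
  let l : m.spectralDomain := ⟨m.ηbar, hηbar⟩
  let k : m.spectralDomain := ⟨m.ηbar + m.τ / 2, add_half_coe_mem_spectralDomain hηbar⟩
  let w : ℂ → ℂ := fun u =>
    v' m.τ m.νbar k u * v m.τ m.νbar l u - v' m.τ m.νbar l u * v m.τ m.νbar k u
  have hg := analyticOnNhd_v_left (m := m) m.η
  have hw : AnalyticOnNhd ℂ w (regularSet m.τ m.ν m.νbar) :=
    ((analyticOnNhd_v'_right k).mul (analyticOnNhd_v_right l)).sub
      ((analyticOnNhd_v'_right l).mul (analyticOnNhd_v_right k))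
  have hgw : ∃ u ∈ regularSet m.τ m.ν m.νbar, v m.τ m.ν m.η u ^ 2 * w u ≠ 0 := by
    by_contra! h
    rcases (hg.pow 2).eq_zero_or_eq_zero_of_mul_eq_zero hw h isPreconnected_regularSet with h1 | h1
    · obtain ⟨u, hu, hne⟩ := exists_v_ne_zero hν m.νbar hη
      exact pow_ne_zero 2 hne (h1 u hu)
    · obtain ⟨u, hu, hne⟩ := exists_wronskian_v_ne_zero hνbar m.ν k.2 l.2
        (exp_multiplier_ne m.τ m.ηbar)
      exact hne (h1 u (regularSet_swap ▸ hu))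
  rintro ⟨q₀, p₀⟩ hx
  have hq₀ := mem_closure_ne_zero ((hg.pow 2).mul hw) isPreconnected_regularSet isOpen_regularSet
    hgw hx
  -- Two approximations: first move q to make the leading coefficient nonzero, then move p with q
  -- fixed.
  rw [← closure_closure]
  refine map_mem_closure (f := fun q => (q, p₀)) (by fun_prop) hq₀ ?_
  rintro q ⟨hq, hα⟩
  obtain ⟨β, γ, hβγ⟩ := minor_mul_exp_sq k l q
  set α := v m.τ m.ν m.η q ^ 2 * w q with hαdef
  let f : ℂ → ℂ := fun p => α * exp (p / m.c) ^ 2 + β * exp (p / m.c) + γ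
  have hf : AnalyticOnNhd ℂ f Set.univ := by
    have : Differentiable ℂ f := by fun_prop
    exact fun p _ => this.analyticAt p
  have hne : ∃ p ∈ Set.univ, f p ≠ 0 := by
    by_contra! h
    -- The quadratic is evaluated at e^{p/c} = 1, −1, 2; the combination below is its second divided
    -- difference, which is α.
    have h1 : ∀ s, exp s = 1 → α + β + γ = 0 := fun s hs => by
      simpa [f, hc, hs] using h (s * m.c) trivial
    have h2 := h (Real.pi * I * m.c) trivial
    have h3 := h (Complex.log 2 * m.c) trivial
    simp only [f, mul_div_cancel_right₀ _ hc, Complex.exp_pi_mul_I,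
      Complex.exp_log two_ne_zero] at h2 h3
    refine hα ?_
    change α = 0
    linear_combination h3 / 3 - h1 0 Complex.exp_zero / 2 + h2 / 6
  have hp₀ := mem_closure_ne_zero hf isPreconnected_univ isOpen_univ hne (Set.mem_univ p₀)
  refine map_mem_closure (f := fun p => (q, p)) (by fun_prop) hp₀ ?_
  rintro p ⟨-, hfp⟩
  refine mem_nondegenerateSet_iff.2 ⟨hq, (k, 0, 1), (l, 0, 1), fun h0 => ?_⟩
  have h1 := hβγ p
  rw [h0, zero_mul, mul_zero] at h1
  exact mul_ne_zero (one_div_ne_zero hc) hfp h1.symm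

/-! ### Hamilton's equations versus the Lax equation -/

lemma laxAt_of_hamiltonAt (hη : 2 * m.η ∉ m.lattice) (hηbar : 2 * m.ηbar ∉ m.lattice)
    {q p : ℝ → ℂ} {t : ℝ} (hx : (q t, p t) ∈ m.phaseSpace) (h : m.HamiltonAt q p t) :
    m.LaxAt q p t := by
  intro z hz i j
  refine (hasDerivAt_lax (q := q) z hx h.1 h.2 i j).congr_deriv ?_
  rw [laxCommutator_eq hη hηbar hz hx]
  simp only [Matrix.sub_apply, Matrix.smul_apply, smul_eq_mul]
  ring

/-- The Lax equation as an algebraic condition on the velocity. -/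
lemma velocity_eq_of_laxEqAt {z : ℂ} {q p : ℝ → ℂ} {t : ℝ} {a b : ℂ}
    (hx : (q t, p t) ∈ m.phaseSpace) (hq : HasDerivAt q a t) (hp : HasDerivAt p b t)
    (h : m.LaxEqAt z q p t) :
    a • m.laxDq z (q t) (p t) + b • m.laxDp z (q t) (p t) = m.laxCommutator z (q t) (p t) := by
  ext i j
  simpa using (hasDerivAt_lax (q := q) z hx hq hp i j).unique (h i j)

lemma hamiltonAt_of_laxEqAt (hη : 2 * m.η ∉ m.lattice) (hηbar : 2 * m.ηbar ∉ m.lattice)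
    {q p : ℝ → ℂ} {t : ℝ} (hx : (q t, p t) ∈ m.phaseSpace) (hq : DifferentiableAt ℝ q t)
    (hp : DifferentiableAt ℝ p t) (hH : m.dqH (q t) (p t) ≠ 0 ∨ m.dpH (q t) (p t) ≠ 0) {z : ℂ}
    (hz : z ∈ m.spectralDomain) (hcomm : m.laxCommutator z (q t) (p t) ≠ 0)
    (h : m.LaxEqAt z q p t) : m.HamiltonAt q p t := by
  have h1 := velocity_eq_of_laxEqAt hx hq.hasDerivAt hp.hasDerivAt h
  have h2 := laxCommutator_eq hη hηbar hz hx (p t)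
  have hHp := laxDp_trace (m := m) z (q t) (p t)
  have hHq := laxDq_trace hz hx (p t)
  rw [HamiltonAt]
  suffices hs : deriv q t = m.dpH (q t) (p t) ∧ deriv p t = -m.dqH (q t) (p t) by
    rw [← hs.1, ← hs.2]
    exact ⟨hq.hasDerivAt, hp.hasDerivAt⟩
  generalize deriv q t = a at *
  generalize deriv p t = b at *
  generalize m.laxDq z (q t) (p t) = A at *
  generalize m.laxDp z (q t) (p t) = B at *
  generalize m.dqH (q t) (p t) = Hq at *
  generalize m.dpH (q t) (p t) = Hp at *
  rw [h2] at h1 hcomm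
  -- The trace of the Lax equation: the right-hand side contributes H_p H_q − H_q H_p = 0.
  have htr : a * Hq + b * Hp = 0 := by
    have h00 := congrFun (congrFun h1 0) 0
    have h11 := congrFun (congrFun h1 1) 1
    simp only [Matrix.add_apply, Matrix.sub_apply, Matrix.smul_apply, smul_eq_mul] at h00 h11
    linear_combination h00 + h11 - (a - Hp) * hHq - (b + Hq) * hHp
  obtain ⟨r, ha, hb⟩ : ∃ r : ℂ, a = r * Hp ∧ b = -(r * Hq) := by
    rcases hH with hne | hne
    · refine ⟨-b / Hq, ?_, ?_⟩
      · field_simp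
        linear_combination htr
      · field_simp
    · refine ⟨a / Hp, ?_, ?_⟩
      · field_simp
      · field_simp
        linear_combination htr
  have h3 : (r - 1) • (Hp • A - Hq • B) = 0 := by
    rw [sub_smul, one_smul, sub_eq_zero]
    refine Eq.trans ?_ h1
    rw [ha, hb]
    module
  have hr : r = 1 := sub_eq_zero.1 ((smul_eq_zero.1 h3).resolve_right hcomm)
  subst hr
  exact ⟨by rw [ha, one_mul], by rw [hb, one_mul]⟩

/-- At a nondegenerate point, only the Hamiltonian velocity solves the Lax equation. -/
lemma velocity_unique (hη : 2 * m.η ∉ m.lattice) (hηbar : 2 * m.ηbar ∉ m.lattice)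
    {x : ℂ × ℂ} (hx : x ∈ m.nondegenerateSet) {a b : ℂ}
    (h : ∀ z ∈ m.spectralDomain,
      a • m.laxDq z x.1 x.2 + b • m.laxDp z x.1 x.2 = m.laxCommutator z x.1 x.2) :
    a = m.dpH x.1 x.2 ∧ b = -m.dqH x.1 x.2 := by
  have hX : x.1 ∈ regularSet m.τ m.ν m.νbar := hx.1
  have h1 := hx.2 (a - m.dpH x.1 x.2) (b + m.dqH x.1 x.2) fun z hz => by
    have h2 := h z hz
    rw [laxCommutator_eq hη hηbar hz hX] at h2
    rw [laxVariation_eq z hX, sub_smul, add_smul, ← sub_eq_zero.2 h2]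
    module
  exact ⟨sub_eq_zero.1 h1.1, eq_neg_of_add_eq_zero_left h1.2⟩

lemma hamiltonAt_of_laxAt (hη : 2 * m.η ∉ m.lattice) (hηbar : 2 * m.ηbar ∉ m.lattice)
    {q p : ℝ → ℂ} {t : ℝ} (hx : (q t, p t) ∈ m.nondegenerateSet) (hq : DifferentiableAt ℝ q t)
    (hp : DifferentiableAt ℝ p t) (h : m.LaxAt q p t) : m.HamiltonAt q p t := by
  have h1 := velocity_unique hη hηbar hx fun z hz =>
    velocity_eq_of_laxEqAt hx.1 hq.hasDerivAt hp.hasDerivAt (h z hz)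
  rw [HamiltonAt, ← h1.1, ← h1.2]
  exact ⟨hq.hasDerivAt, hp.hasDerivAt⟩

/-- Functions continuous on the phase space that agree at its nondegenerate points are equal. -/
lemma eqOn_phaseSpace (hd : m.phaseSpace ⊆ closure m.nondegenerateSet) {f g : ℂ × ℂ → ℂ}
    (hf : ContinuousOn f m.phaseSpace) (hg : ContinuousOn g m.phaseSpace)
    (h : Set.EqOn f g m.nondegenerateSet) : Set.EqOn f g m.phaseSpace :=
  h.of_subset_closure hf hg (fun _ hx => hx.1) hd

/-- At nondegenerate points the Lax equation fixes the velocity. The remaining points of the phase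
space are limits of these, and both vector fields are continuous. -/
lemma vectorField_iff (hη : 2 * m.η ∉ m.lattice) (hηbar : 2 * m.ηbar ∉ m.lattice)
    (hd : m.phaseSpace ⊆ closure m.nondegenerateSet) {Q P : ℂ × ℂ → ℂ}
    (hQ : ContinuousOn Q m.phaseSpace) (hP : ContinuousOn P m.phaseSpace) :
    (∀ x ∈ m.phaseSpace, Q x = m.dpH x.1 x.2 ∧ P x = -m.dqH x.1 x.2) ↔
      ∀ x ∈ m.phaseSpace, ∀ z ∈ m.spectralDomain,
        m.laxVariation z x.1 x.2 (Q x) (P x) = m.laxCommutator z x.1 x.2 := by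
  constructor
  · intro h x hx z hz
    rw [laxVariation_eq z (q := x.1) hx, laxCommutator_eq hη hηbar hz (q := x.1) hx, (h x hx).1,
      (h x hx).2, neg_smul, sub_eq_add_neg]
  · intro h x hx
    have hN : ∀ y ∈ m.nondegenerateSet, Q y = m.dpH y.1 y.2 ∧ P y = -m.dqH y.1 y.2 :=
      fun y hy => velocity_unique hη hηbar hy fun z hz => by
        rw [← laxVariation_eq z (q := y.1) hy.1]
        exact h y hy.1 z hz
    exact ⟨eqOn_phaseSpace hd hQ continuousOn_dpH (fun y hy => (hN y hy).1) hx,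
      eqOn_phaseSpace hd hP (continuousOn_dqH hη).neg (fun y hy => (hN y hy).2) hx⟩

end Model

end VanDiejen

end

theorem mainTheorem5 (m : VanDiejen.Model) (hc : m.c ≠ 0)
    (hη : 2 * m.η ∉ m.lattice) (hηbar : 2 * m.ηbar ∉ m.lattice) :
    -- the explicit form of the right-hand sides of Hamilton's equations
    (∀ q p : ℂ, (q, p) ∈ m.phaseSpace →
      HasDerivAt (fun y => m.hamiltonian q y)
        (1 / m.c * (VanDiejen.v m.τ m.ν m.η q * VanDiejen.v m.τ m.νbar m.ηbar q * exp (p / m.c)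
          - VanDiejen.v m.τ m.ν m.η (-q) * VanDiejen.v m.τ m.νbar m.ηbar (-q)
            * exp (-p / m.c))) p ∧
      HasDerivAt (fun x => m.hamiltonian x p)
        (deriv (fun u => VanDiejen.v m.τ m.ν m.η u * VanDiejen.v m.τ m.νbar m.ηbar u) q
            * exp (p / m.c)
          - deriv (fun u => VanDiejen.v m.τ m.ν m.η u * VanDiejen.v m.τ m.νbar m.ηbar u) (-q)
            * exp (-p / m.c)
          - 2 * ∑ a, m.ν a * m.νbar a *
              (VanDiejen.periods m.τ).derivWeierstrassP (q + VanDiejen.halfPeriod m.τ a)) q) ∧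
    -- Hamilton's equations imply the Lax equation
    (∀ (q p : ℝ → ℂ) (t : ℝ), (q t, p t) ∈ m.phaseSpace →
      m.HamiltonAt q p t → m.LaxAt q p t) ∧
    -- conversely, one value of the spectral parameter with nonzero commutator suffices if `dH ≠ 0`
    (∀ (q p : ℝ → ℂ) (t : ℝ), (q t, p t) ∈ m.phaseSpace →
      DifferentiableAt ℝ q t → DifferentiableAt ℝ p t →
      (m.dqH (q t) (p t) ≠ 0 ∨ m.dpH (q t) (p t) ≠ 0) →
      ∀ z ∈ m.spectralDomain, m.laxCommutator z (q t) (p t) ≠ 0 →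
        m.LaxEqAt z q p t → m.HamiltonAt q p t) ∧
    -- for nonzero coupling vectors the two are equivalent
    (m.ν ≠ 0 → m.νbar ≠ 0 →
      -- for curves, at the points of an open dense subset of the phase space
      (IsOpen m.nondegenerateSet ∧ m.phaseSpace ⊆ closure m.nondegenerateSet ∧
        ∀ (q p : ℝ → ℂ) (t : ℝ), (q t, p t) ∈ m.nondegenerateSet →
          DifferentiableAt ℝ q t → DifferentiableAt ℝ p t →
          (m.HamiltonAt q p t ↔ m.LaxAt q p t)) ∧
      -- for the dynamics `q̇ = Q(q, p)`, `ṗ = P(q, p)`, on the whole phase space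
      (∀ Q P : ℂ × ℂ → ℂ, ContinuousOn Q m.phaseSpace → ContinuousOn P m.phaseSpace →
        ((∀ x ∈ m.phaseSpace, Q x = m.dpH x.1 x.2 ∧ P x = -m.dqH x.1 x.2) ↔
          ∀ x ∈ m.phaseSpace, ∀ z ∈ m.spectralDomain,
            m.laxVariation z x.1 x.2 (Q x) (P x) = m.laxCommutator z x.1 x.2))) := by
  refine ⟨fun q p hx => ⟨VanDiejen.Model.hasDerivAt_hamiltonian_right q p,
      VanDiejen.Model.hasDerivAt_hamiltonian_left hx p⟩,
    fun q p t hx h => VanDiejen.Model.laxAt_of_hamiltonAt hη hηbar hx h,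
    fun q p t hx hq hp hH z hz hcomm h =>
      VanDiejen.Model.hamiltonAt_of_laxEqAt hη hηbar hx hq hp hH hz hcomm h,
    fun hν hνbar => ?_⟩
  have hd := VanDiejen.Model.phaseSpace_subset_closure hc hη hηbar hν hνbar
  exact ⟨⟨VanDiejen.Model.isOpen_nondegenerateSet, hd, fun q p t hx hq hp =>
      ⟨fun h => VanDiejen.Model.laxAt_of_hamiltonAt hη hηbar hx.1 h,
        fun h => VanDiejen.Model.hamiltonAt_of_laxAt hη hηbar hx hq hp h⟩⟩,
    fun Q P hQ hP => VanDiejen.Model.vectorField_iff hη hηbar hd hQ hP⟩
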